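/- Consider the ARX system $$y_{n+1}+\sum_{i=1}^{p_0}a_i y_{n+1-i}=\sum_{j=1}^{q_0}b_j u_{n+1-j}+w_{n+1},\qquad n\ge 0,$$ where $y_n=u_n=0$ for $n<0$, $y_0$ and $u_0$ are real random variables, $b_{q_0}\ne 0$, and $a_{p_0}\neq 0$ if $p_0\ge1$. Only the quantized output $s_n=\varepsilon\lfloor y_n/\varepsilon+1/2\rfloor$, with $\varepsilon>0$, is observed. For $p,q\ge 0$ let $$\psi_i(p,q)=[s_i,\dots,s_{i-p+1},u_i,\dots,u_{i-q+1}]^\top$$ (with $s_j$ and $u_j$ replaced by $0$ for $j\le 0$), $P_{n}(p,q)=\bigl(I+\sum_{i=0}^{n-1}\psi_i(p,q)\psi_i(p,q)^\top\bigr)^{-1}$, let $\lambda^{(p,q)}_{\min}(n)$ and $\lambda^{(p,q)}_{\max}(n)$ be the smallest and largest eigenvalues of $P_{n+1}(p,q)^{-1}$, and put $$\theta_n(p,q)=P_n(p,q)\sum_{i=0}^{n-1}\psi_i(p,q)s_{i+1},\qquad \sigma_n(p,q)=\sum_{i=0}^{n-1}\bigl(s_{i+1}-\theta_n(p,q)^\top\psi_i(p,q)\bigr)^2,\qquad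 V_n(p,q)=\sigma_n(p,q)+v_n(p+q),$$ where $(v_n)$ is a deterministic real sequence. Assume: 1. $(u_n)_{n\ge1}$ is i.i.d., uniformly distributed on $[-\delta,\delta]$, $\delta>0$; $(w_n)_{n\ge1}$ is i.i.d. $N(0,1)$, and for every $n\ge0$ the variable $w_{n+1}$ is independent of $(y_0,u_0,\dots,u_n,w_1,\dots,w_n)$. 2. $1+\sum_{i=1}^{p_0}a_iz^i\ne0$ for all complex $z$ with $|z|\le1$. 3. $c>0$, $|a_i|\le c$ for $1\le i\le p_0$, $|b_j|\le c$ for $1\le j\le q_0$, and $\varepsilon<\frac{1}{2(1+p_0c)}$. 4. $0\le p_0\le p^*$ and $1\le q_0\le q^*$, where $p^*>0$ and $q^*>0$ are known integers. 5. (Persistent excitation) $c_2>0$ is a constant such that, for every $0\le q\le q^*$, almost surely $\lambda^{(p^*,q)}_{\min}(n)\ge c_2(n+1)$ for all sufficiently large $n$. For $0\le q\le q_0$ let $\tilde\theta_n(q)$ be $[-a_1,\dots,-a_{p^*},b_1,\dots,b_{q_0}]^\top$ (with $a_i=0$ for $i>p_0$) minus $\theta_n(p^*,q)$ extended by $q_0-q$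 zeros at the end. Then there exist deterministic constants $c_4>0$ and $\gamma'$ such that almost surely, for all sufficiently large $n$, $$\lambda^{(p^*,q_0)}_{\max}(n)\le c_4(n+1)\quad\text{and}\quad \|\tilde\theta_n(q)\|\le\gamma'\ \text{ for all } 0\le q\le q_0 .\tag{1}$$ Moreover, for all constants $c_4>0$ and $\gamma'$ satisfying (1), all $\beta_1>0$ and $0<\beta_2<1$, if for all $n\ge1$ $$[5(1+p^*c)\varepsilon+\beta_1]\,n\le v_n\le\frac{\beta_2}{q^*}\Bigl[b_{q_0}^2c_2-2\gamma'\sqrt{c_4(1+p^*c)\varepsilon}-3(1+p^*c)\varepsilon\Bigr]n,$$ then every choice of $\hat q_n\in\operatorname{argmin}_{0\le q\le q^*}V_n(p^*,q)$ satisfies $\hat q_n\to q_0$ almost surely as $n\to\infty$. -/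

import Mathlib

open MeasureTheory ProbabilityTheory Filter Topology

namespace QuantARX

noncomputable section

/-- Value at time `m : ℤ` of a sequence started at time `0`, with value zero at negative times. -/
def fromZero (x : ℕ → ℝ) (m : ℤ) : ℝ := if 0 ≤ m then x m.toNat else 0

/-- Value at time `m : ℤ` of a sequence started at time `1`, with value zero at times `≤ 0`. -/
def fromOne (x : ℕ → ℝ) (m : ℤ) : ℝ := if 0 < m then x m.toNat else 0

/-- The ARX recursion `A(z) y_{n+1} = B(z) u_n + w_{n+1}`, `n ≥ 0`, along one sample path, where
`A(z) = 1 + a₁ z + ⋯ + a_{p₀} z^{p₀}`, `B(z) = b₁ + b₂ z + ⋯ + b_{q₀} z^{q₀-1}`, `z` is the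
backward shift, and `y`, `u` vanish at negative times. -/
def IsARXPath (p₀ q₀ : ℕ) (a b : ℕ → ℝ) (y u w : ℕ → ℝ) : Prop :=
  ∀ n : ℕ,
    y (n + 1) + ∑ i ∈ Finset.Icc 1 p₀, a i * fromZero y ((n : ℤ) + 1 - i)
      = ∑ j ∈ Finset.Icc 1 q₀, b j * fromZero u ((n : ℤ) + 1 - j) + w (n + 1)

/-- `A(z) ≠ 0` for every complex `z` with `|z| ≤ 1`. -/
def IsStable (p₀ : ℕ) (a : ℕ → ℝ) : Prop :=
  ∀ z : ℂ, ‖z‖ ≤ 1 → 1 + ∑ i ∈ Finset.Icc 1 p₀, (a i : ℂ) * z ^ i ≠ 0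

/-- The uniform quantizer with step `ε`. -/
def quantize (ε x : ℝ) : ℝ := ε * (⌊x / ε + 1 / 2⌋ : ℝ)

/-- The regressor `ψ_i(p,q) = [s_i, …, s_{i-p+1}, u_i, …, u_{i-q+1}]ᵀ`, with `s` and `u` set to
zero at times `≤ 0`. -/
def regressor (s u : ℕ → ℝ) (p q i : ℕ) : Fin p ⊕ Fin q → ℝ :=
  Sum.elim (fun k => fromOne s ((i : ℤ) - (k : ℕ))) (fun k => fromOne u ((i : ℤ) - (k : ℕ)))

/-- `P_n(p,q)⁻¹ = I + ∑_{i=0}^{n-1} ψ_i ψ_iᵀ`. -/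
def infoMatrix (s u : ℕ → ℝ) (p q n : ℕ) : Matrix (Fin p ⊕ Fin q) (Fin p ⊕ Fin q) ℝ :=
  1 + ∑ i ∈ Finset.range n, Matrix.vecMulVec (regressor s u p q i) (regressor s u p q i)

theorem infoMatrix_isHermitian (s u : ℕ → ℝ) (p q n : ℕ) :
    (infoMatrix s u p q n).IsHermitian := by
  ext i j
  simp [infoMatrix, Matrix.sum_apply, Matrix.vecMulVec_apply, Matrix.one_apply, mul_comm, eq_comm]

/-- `λ_min^{(p,q)}(n)`, the smallest eigenvalue of `P_{n+1}(p,q)⁻¹` (for `p + q ≥ 1`). -/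
def lambdaMin (s u : ℕ → ℝ) (p q n : ℕ) : ℝ :=
  ⨅ k, (infoMatrix_isHermitian s u p q (n + 1)).eigenvalues k

/-- `λ_max^{(p,q)}(n)`, the largest eigenvalue of `P_{n+1}(p,q)⁻¹` (for `p + q ≥ 1`). -/
def lambdaMax (s u : ℕ → ℝ) (p q n : ℕ) : ℝ :=
  ⨆ k, (infoMatrix_isHermitian s u p q (n + 1)).eigenvalues k

/-- The estimate `θ_n(p,q) = P_n(p,q) ∑_{i=0}^{n-1} ψ_i(p,q) s_{i+1}`. -/
def thetaHat (s u : ℕ → ℝ) (p q n : ℕ) : Fin p ⊕ Fin q → ℝ :=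
  (infoMatrix s u p q n)⁻¹.mulVec
    (∑ i ∈ Finset.range n, s (i + 1) • regressor s u p q i)

/-- The residual sum of squares `σ_n(p,q)`. -/
def sigma (s u : ℕ → ℝ) (p q n : ℕ) : ℝ :=
  ∑ i ∈ Finset.range n, (s (i + 1) - thetaHat s u p q n ⬝ᵥ regressor s u p q i) ^ 2

/-- The criterion `V_n(p,q) = σ_n(p,q) + v_n (p + q)`. -/
def criterion (v : ℕ → ℝ) (s u : ℕ → ℝ) (p q n : ℕ) : ℝ :=
  sigma s u p q n + v n * ((p : ℝ) + (q : ℝ))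

/-- `q` is a minimizer of `V_n(p*, ·)` over `{0, …, q*}`. -/
def IsOrderEstimate (v : ℕ → ℝ) (s u : ℕ → ℝ) (ps qs n q : ℕ) : Prop :=
  q ≤ qs ∧ ∀ q' ≤ qs, criterion v s u ps q n ≤ criterion v s u ps q' n

/-- The true parameter `θ̄(p,q) = [-a₁, …, -a_p, b₁, …, b_q]ᵀ`, with `a_i = 0` for `i > p₀` and
`b_j = 0` for `j > q₀`. -/
def thetaBar (p₀ q₀ : ℕ) (a b : ℕ → ℝ) (p q : ℕ) : Fin p ⊕ Fin q → ℝ :=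
  Sum.elim (fun k => if (k : ℕ) + 1 ≤ p₀ then -a ((k : ℕ) + 1) else 0)
    (fun k => if (k : ℕ) + 1 ≤ q₀ then b ((k : ℕ) + 1) else 0)

/-- The vector `θ_n(p,q)`, `q ≤ q₀`, with its exogenous part padded by zeros to length `q₀`. -/
def paddedEstimate (s u : ℕ → ℝ) (p q₀ q n : ℕ) : Fin p ⊕ Fin q₀ → ℝ :=
  Sum.elim (fun k => thetaHat s u p q n (Sum.inl k))
    (fun k => if h : (k : ℕ) < q then thetaHat s u p q n (Sum.inr ⟨k, h⟩) else 0)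

/-- The Euclidean norm of the error between `θ̄(p,q₀)` and the zero-padded `θ_n(p,q)`. -/
def errorNorm (p₀ q₀ : ℕ) (a b : ℕ → ℝ) (s u : ℕ → ℝ) (p q n : ℕ) : ℝ :=
  ‖(WithLp.toLp 2 (thetaBar p₀ q₀ a b p q₀ - paddedEstimate s u p q₀ q n) :
      EuclideanSpace ℝ (Fin p ⊕ Fin q₀))‖

end

end QuantARX

/-! Replacing `y` by `s` in the recursion gives, after finitely many steps, a linear regression
`s_{i+1} = θ̄ᵀψ_i + w_{i+1} + η_i`. Here `η_i` collects the quantization errors at times `i+1` and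
`i, …, i-p₀+1`, so `|η_i| ≤ (1+p₀c)ε/2`. As `ε` is small, `∑ η_i² ≤ K n` eventually, with `K =
(1+p*c)ε`. Let `m_i = w_{i+1} + η_i`. Every `σ_n(p*,q)` is compared with `∑ m_i²`.

At `q = q₀`, ridge optimality gives `σ_n ≤ ∑ m_i² + ‖θ̄‖²`. For `q > q₀`, completing the square
gives `σ_n ≥ ∑ m_i² - K n - o(n)`, so the lower bound on `v_n` outweighs any gain from overfitting.
For `q < q₀`, the zero-padded error has a coordinate equal to `b_{q₀}`. Persistent excitation turns
it into a surplus `b_{q₀}² c₂ n`, reduced by at most `2γ'√(c₄K) n` (Cauchy–Schwarz against `η`) and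
`o(n)`; the upper bound on `v_n` keeps the penalty below this surplus. The estimate therefore equals
`q₀` eventually.

Two ingredients are probabilistic. The correlations `∑ ψ_i w_{i+1}` are `o(n)`, by a strong law for
martingale transforms (`ae_tendsto_sum_mul_noise_div`). The data are mean-square bounded with a
deterministic constant, by stability (`exists_linearGrowth_of_isStable`) and the law of large
numbers for `w²`. Together with persistent excitation, the latter also yields `c₄` and `γ'`. The
remaining argument is pathwise (`tendsto_orderEstimate`). -/

namespace QuantARX

/-- The partial sums of `f` grow at most linearly, with slope `K`. -/
def LinearGrowth (K : ℝ) (f : ℕ → ℝ) : Prop :=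
  ∃ R : ℝ, ∀ n : ℕ, ∑ i ∈ Finset.range n, f i ≤ K * n + R

/-! ### Linear growth of partial sums, and stable recursions -/

namespace LinearGrowth

variable {K L : ℝ} {f g : ℕ → ℝ}

theorem of_eventually_le (hf : LinearGrowth K f) (h : ∀ᶠ i in atTop, g i ≤ f i) :
    LinearGrowth K g := by
  obtain ⟨R, hR⟩ := hf
  obtain ⟨N, hN⟩ := eventually_atTop.1 h
  refine ⟨R + ∑ i ∈ Finset.range N, |g i - f i|, fun n => ?_⟩
  have key : ∑ i ∈ Finset.range n, (g i - f i) ≤ ∑ i ∈ Finset.range N, |g i - f i| := by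
    induction n with
    | zero => simpa using Finset.sum_nonneg fun i _ => abs_nonneg (g i - f i)
    | succ n ih =>
      by_cases hn : n < N
      · refine (Finset.sum_le_sum fun i _ => le_abs_self (g i - f i)).trans ?_
        exact Finset.sum_le_sum_of_subset_of_nonneg (Finset.range_subset_range.2 hn)
          fun i _ _ => abs_nonneg _
      · rw [Finset.sum_range_succ]
        have := hN n (not_lt.1 hn)
        linarith
  rw [Finset.sum_sub_distrib] at key
  linarith [hR n]

theorem mono (hf : LinearGrowth K f) (h : ∀ i, g i ≤ f i) : LinearGrowth K g :=
  hf.of_eventually_le (Eventually.of_forall h)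

theorem add (hf : LinearGrowth K f) (hg : LinearGrowth L g) :
    LinearGrowth (K + L) fun i => f i + g i := by
  obtain ⟨R, hR⟩ := hf
  obtain ⟨S, hS⟩ := hg
  refine ⟨R + S, fun n => ?_⟩
  rw [Finset.sum_add_distrib]
  linarith [hR n, hS n]

theorem const_mul (hf : LinearGrowth K f) {A : ℝ} (hA : 0 ≤ A) :
    LinearGrowth (A * K) fun i => A * f i := by
  obtain ⟨R, hR⟩ := hf
  refine ⟨A * R, fun n => ?_⟩
  rw [← Finset.mul_sum]
  nlinarith [mul_le_mul_of_nonneg_left (hR n) hA]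

theorem const (K : ℝ) : LinearGrowth K fun _ => K :=
  ⟨0, fun n => by simp [mul_comm]⟩

theorem shift (hf : LinearGrowth K f) (h0 : ∀ i, 0 ≤ f i) (p : ℕ) :
    LinearGrowth K fun i => f (i + p) := by
  obtain ⟨R, hR⟩ := hf
  refine ⟨K * p + R, fun n => ?_⟩
  have h1 := hR (n + p)
  have h2 := Finset.sum_range_add f p n
  rw [add_comm p n] at h2
  have h3 : 0 ≤ ∑ i ∈ Finset.range p, f i := Finset.sum_nonneg fun i _ => h0 i
  push_cast at h1
  simp only [add_comm p] at h2
  linarith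

/-- The hypothesis starts at time 1 because inputs and noise are controlled only from there.
Truncated subtraction repeats `f 0` finitely often, which affects only the additive constant. -/
theorem delay (hf : LinearGrowth K fun i => f (i + 1)) (h0 : ∀ i, 0 ≤ f i) (hK : 0 ≤ K) (p : ℕ) :
    LinearGrowth K fun i => f (i - p) := by
  obtain ⟨R, hR⟩ := hf
  have hf0 : ∀ n, ∑ i ∈ Finset.range n, f i ≤ K * n + (|R| + f 0) := by
    intro n
    cases n with
    | zero => simpa using add_nonneg (abs_nonneg R) (h0 0)
    | succ n =>
      rw [Finset.sum_range_succ']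
      push_cast
      linarith [hR n, le_abs_self R]
  refine ⟨p * f 0 + (|R| + f 0), fun n => ?_⟩
  by_cases hn : n ≤ p
  · have : ∀ i ∈ Finset.range n, f (i - p) = f 0 := fun i hi => by
      rw [Nat.sub_eq_zero_of_le ((Finset.mem_range.1 hi).le.trans hn)]
    rw [Finset.sum_congr rfl this]
    simp only [Finset.sum_const, Finset.card_range, nsmul_eq_mul]
    have : (n : ℝ) * f 0 ≤ p * f 0 := mul_le_mul_of_nonneg_right (by exact_mod_cast hn) (h0 0)
    have := abs_nonneg R
    have := h0 0
    have : 0 ≤ K * n := by positivity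
    linarith
  · obtain ⟨m, rfl⟩ := Nat.exists_eq_add_of_le (not_le.1 hn).le
    rw [Finset.sum_range_add]
    have : ∀ i ∈ Finset.range p, f (i - p) = f 0 := fun i hi => by
      rw [Nat.sub_eq_zero_of_le (Finset.mem_range.1 hi).le]
    rw [Finset.sum_congr rfl this]
    simp only [Finset.sum_const, Finset.card_range, nsmul_eq_mul, Nat.add_sub_cancel_left]
    push_cast
    have : 0 ≤ K * p := by positivity
    linarith [hf0 m]

theorem eventually_le (hf : LinearGrowth K f) (h : K < L) :
    ∀ᶠ n : ℕ in atTop, ∑ i ∈ Finset.range n, f i ≤ L * n := by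
  obtain ⟨R, hR⟩ := hf
  have : Tendsto (fun n : ℕ => (L - K) * (n : ℝ)) atTop atTop :=
    tendsto_natCast_atTop_atTop.const_mul_atTop (sub_pos.2 h)
  filter_upwards [this.eventually_ge_atTop R] with n hn
  linarith [hR n]

theorem of_eventually_sum_le (h : ∀ᶠ n : ℕ in atTop, ∑ i ∈ Finset.range n, f i ≤ K * n) :
    LinearGrowth K f := by
  obtain ⟨N, hN⟩ := eventually_atTop.1 h
  refine ⟨∑ n ∈ Finset.range N, |∑ i ∈ Finset.range n, f i - K * n|, fun n => ?_⟩
  by_cases hn : n < N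
  · have := Finset.single_le_sum (f := fun n : ℕ => |∑ i ∈ Finset.range n, f i - K * n|)
      (fun i _ => abs_nonneg _) (Finset.mem_range.2 hn)
    have h2 := le_abs_self (∑ i ∈ Finset.range n, f i - K * n)
    linarith
  · have := hN n (not_lt.1 hn)
    have h2 : 0 ≤ ∑ n ∈ Finset.range N, |∑ i ∈ Finset.range n, f i - K * n| :=
      Finset.sum_nonneg fun i _ => abs_nonneg _
    linarith

end LinearGrowth

/-- The left shift on complex sequences. -/
def shiftEnd : Module.End ℂ (ℕ → ℂ) where
  toFun x n := x (n + 1)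
  map_add' _ _ := rfl
  map_smul' _ _ := rfl

theorem shiftEnd_pow_apply (k : ℕ) (x : ℕ → ℂ) (n : ℕ) : (shiftEnd ^ k) x n = x (n + k) := by
  induction k generalizing n with
  | zero => simp
  | succ k ih =>
    rw [pow_succ', Module.End.mul_apply]
    change (shiftEnd ^ k) x (n + 1) = _
    rw [ih]
    congr 1
    omega

/-- Convexity of the square, applied to the weights `‖r‖` and `1 - ‖r‖`, gives a contractive
recursion for `‖g n‖²`, which is then summed. The initial value enters only the additive constant,
so the slope is the same for all solutions. -/
theorem linearGrowth_of_first_order {r : ℂ} (hr : ‖r‖ < 1) {K : ℝ} {f g : ℕ → ℂ}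
    (hfg : ∀ n, g (n + 1) = r * g n + f n) (hf : LinearGrowth K fun i => ‖f i‖ ^ 2) :
    LinearGrowth (K / (1 - ‖r‖) ^ 2) fun i => ‖g i‖ ^ 2 := by
  obtain ⟨R, hR⟩ := hf
  have hd : 0 < 1 - ‖r‖ := sub_pos.2 hr
  have step : ∀ n, ‖g (n + 1)‖ ^ 2 ≤ ‖r‖ * ‖g n‖ ^ 2 + ‖f n‖ ^ 2 / (1 - ‖r‖) := by
    intro n
    have h1 : ‖g (n + 1)‖ ≤ ‖r‖ * ‖g n‖ + ‖f n‖ := by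
      rw [hfg, ← norm_mul]
      exact norm_add_le _ _
    have h2 : ‖g (n + 1)‖ ^ 2 ≤ (‖r‖ * ‖g n‖ + ‖f n‖) ^ 2 :=
      pow_le_pow_left₀ (norm_nonneg _) h1 2
    refine h2.trans ?_
    have h3 : ‖r‖ * ‖g n‖ ^ 2 + ‖f n‖ ^ 2 / (1 - ‖r‖) - (‖r‖ * ‖g n‖ + ‖f n‖) ^ 2
        = ‖r‖ * ((1 - ‖r‖) * ‖g n‖ - ‖f n‖) ^ 2 / (1 - ‖r‖) := by
      field_simp
      ring
    have h4 : 0 ≤ ‖r‖ * ((1 - ‖r‖) * ‖g n‖ - ‖f n‖) ^ 2 / (1 - ‖r‖) := by positivity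
    linarith
  have total : ∀ n, (1 - ‖r‖) * ∑ i ∈ Finset.range n, ‖g i‖ ^ 2 + ‖g n‖ ^ 2
      ≤ ‖g 0‖ ^ 2 + (∑ i ∈ Finset.range n, ‖f i‖ ^ 2) / (1 - ‖r‖) := by
    intro n
    induction n with
    | zero => simp
    | succ n ih =>
      rw [Finset.sum_range_succ, Finset.sum_range_succ, add_div]
      linarith [step n]
  refine ⟨(‖g 0‖ ^ 2 + R / (1 - ‖r‖)) / (1 - ‖r‖), fun n => ?_⟩
  have h1 := total n
  have h2 : (∑ i ∈ Finset.range n, ‖f i‖ ^ 2) / (1 - ‖r‖) ≤ (K * n + R) / (1 - ‖r‖) :=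
    div_le_div_of_nonneg_right (hR n) hd.le
  have h3 : ∑ i ∈ Finset.range n, ‖g i‖ ^ 2
      ≤ (‖g 0‖ ^ 2 + (K * n + R) / (1 - ‖r‖)) / (1 - ‖r‖) := by
    rw [le_div_iff₀ hd]
    nlinarith [sq_nonneg ‖g n‖]
  refine h3.trans (le_of_eq ?_)
  field_simp
  ring

/-- Each factor of the polynomial in the shift is a first-order recursion, inverted one at a time.
`K` is quantified inside because it changes at each inversion; `C` precedes `y`, so that it is later
a deterministic constant. -/
theorem exists_linearGrowth_of_roots (m : Multiset ℂ) (hm : ∀ r ∈ m, ‖r‖ < 1) :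
    ∀ K : ℝ, ∃ C : ℝ, ∀ y : ℕ → ℂ,
      LinearGrowth K (fun i => ‖Polynomial.aeval shiftEnd
        (m.map fun r => Polynomial.X - Polynomial.C r).prod y i‖ ^ 2) →
      LinearGrowth C fun i => ‖y i‖ ^ 2 := by
  induction m using Multiset.induction_on with
  | empty => exact fun K => ⟨K, fun y hy => by simpa using hy⟩
  | cons r m ih =>
    intro K
    have hr := hm r (Multiset.mem_cons_self r m)
    obtain ⟨C, hC⟩ := ih (fun r' h => hm r' (Multiset.mem_cons_of_mem h)) (K / (1 - ‖r‖) ^ 2)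
    refine ⟨C, fun y hy => hC y (linearGrowth_of_first_order hr (fun n => ?_) hy)⟩
    rw [Multiset.map_cons, Multiset.prod_cons, map_mul, Module.End.mul_apply]
    simp [shiftEnd, Algebra.algebraMap_eq_smul_one]

open Polynomial in
/-- A stable linear recursion driven by a mean-square bounded input has a mean-square bounded
output, with a bound which depends on the input only through its mean-square bound. -/
theorem exists_linearGrowth_of_isStable {p : ℕ} {a : ℕ → ℝ} (ha : IsStable p a) (K : ℝ) :
    ∃ C : ℝ, ∀ y : ℕ → ℝ,
      LinearGrowth K (fun n => (y (n + p) + ∑ i ∈ Finset.Icc 1 p, a i * y (n + p - i)) ^ 2) →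
      LinearGrowth C fun i => y i ^ 2 := by
  -- The reversed polynomial `z^p A(1/z)`: a root of modulus at least 1 would have its inverse as a
  -- zero of `A` in the closed disc.
  set Q : ℂ[X] := X ^ p + ∑ i ∈ Finset.Icc 1 p, C (a i : ℂ) * X ^ (p - i) with hQ
  have hdeg : (∑ i ∈ Finset.Icc 1 p, C (a i : ℂ) * X ^ (p - i)).degree < (p : WithBot ℕ) := by
    refine (degree_sum_le _ _).trans_lt ((Finset.sup_lt_iff (WithBot.bot_lt_coe p)).2 ?_)
    intro i hi
    refine (degree_C_mul_X_pow_le _ _).trans_lt ?_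
    have := Finset.mem_Icc.1 hi
    exact Nat.cast_lt.2 (by omega : p - i < p)
  have hmonic : Q.Monic := monic_X_pow_add hdeg
  have hroots : ∀ r ∈ Q.roots, ‖r‖ < 1 := by
    intro r hr
    by_contra! hr1
    have hr0 : r ≠ 0 := by
      rintro rfl
      norm_num at hr1
    have hz : ‖r⁻¹‖ ≤ 1 := by
      rw [norm_inv]
      exact inv_le_one_of_one_le₀ hr1
    refine ha r⁻¹ hz ?_
    have hroot : Q.eval r = 0 := (mem_roots'.1 hr).2
    have heval : Q.eval r = r ^ p * (1 + ∑ i ∈ Finset.Icc 1 p, (a i : ℂ) * r⁻¹ ^ i) := by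
      rw [hQ, mul_add, Finset.mul_sum, eval_add, eval_finsetSum]
      simp only [eval_pow, eval_X, eval_mul, eval_C, mul_one]
      congr 1
      refine Finset.sum_congr rfl fun i hi => ?_
      rw [pow_sub₀ r hr0 (Finset.mem_Icc.1 hi).2, inv_pow]
      ring
    rw [heval] at hroot
    exact (mul_eq_zero.1 hroot).resolve_left (pow_ne_zero _ hr0)
  have hprod : Q = (Q.roots.map fun r => X - C r).prod := by
    have := (IsAlgClosed.splits Q).eq_prod_roots
    rwa [hmonic.leadingCoeff, C_1, one_mul] at this
  obtain ⟨D, hD⟩ := exists_linearGrowth_of_roots Q.roots hroots K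
  refine ⟨D, fun y hy => ?_⟩
  have := hD (fun n => (y n : ℂ)) ?_
  · simpa using this
  · rw [← hprod]
    refine hy.mono fun n => le_of_eq ?_
    have haeval : aeval shiftEnd Q (fun n => (y n : ℂ)) n
        = ((y (n + p) + ∑ i ∈ Finset.Icc 1 p, a i * y (n + p - i) : ℝ) : ℂ) := by
      rw [hQ, map_add, map_sum, LinearMap.add_apply, LinearMap.sum_apply, Pi.add_apply,
        Finset.sum_apply]
      simp only [map_mul, map_pow, aeval_X, aeval_C, Module.End.mul_apply,
        Module.algebraMap_end_apply, Pi.smul_apply, smul_eq_mul, shiftEnd_pow_apply]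
      push_cast
      congr 1
      refine Finset.sum_congr rfl fun i hi => ?_
      rw [Nat.add_sub_assoc (Finset.mem_Icc.1 hi).2]
    rw [haeval, Complex.norm_real, Real.norm_eq_abs, sq_abs]

end QuantARX

/-! ### Strong law for martingale transforms -/

namespace QuantARX

theorem indepFun_of_indep_comap {Ω : Type*} {m _ : MeasurableSpace Ω} {P : Measure Ω}
    {X f : Ω → ℝ}
    (h : Indep (MeasurableSpace.comap X inferInstance) m P) (hf : Measurable[m] f) :
    IndepFun X f P :=
  (IndepFun_iff_Indep X f P).2 (indep_of_indep_of_le_right h hf.comap_le)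

section Martingale

variable {Ω : Type*} {m0 : MeasurableSpace Ω} {P : Measure Ω} [IsProbabilityMeasure P]
  {ℱ : Filtration ℕ m0} {ξ : ℕ → Ω → ℝ}

/-- A martingale transform of a unit-variance noise whose weights have total energy at most `1`
converges almost surely. -/
theorem ae_tendsto_sum_mul_noise (hξ : ∀ n, Measurable[ℱ (n + 1)] (ξ n))
    (hind : ∀ n, Indep (MeasurableSpace.comap (ξ n) inferInstance) (ℱ n) P)
    (hL2 : ∀ n, MemLp (ξ n) 2 P) (hmean : ∀ n, ∫ ω, ξ n ω ∂P = 0)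
    (hvar : ∀ n, ∫ ω, ξ n ω ^ 2 ∂P = 1)
    {φ : ℕ → Ω → ℝ} (hφ : ∀ n, Measurable[ℱ n] (φ n))
    (hsum : ∀ n ω, ∑ i ∈ Finset.range n, φ i ω ^ 2 ≤ 1) :
    ∀ᵐ ω ∂P, ∃ l, Tendsto (fun n => ∑ i ∈ Finset.range n, φ i ω * ξ i ω) atTop (𝓝 l) := by
  set M : ℕ → Ω → ℝ := fun n ω => ∑ i ∈ Finset.range n, φ i ω * ξ i ω with hM
  have hMsucc : ∀ n ω, M (n + 1) ω = M n ω + φ n ω * ξ n ω := fun n ω =>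
    Finset.sum_range_succ _ _
  have hφm : ∀ n, Measurable (φ n) := fun n => (hφ n).mono (ℱ.le n) le_rfl
  have hξm : ∀ n, Measurable (ξ n) := fun n => (hξ n).mono (ℱ.le _) le_rfl
  have hφ1 : ∀ n ω, φ n ω ^ 2 ≤ 1 := by
    intro n ω
    refine le_trans ?_ (hsum (n + 1) ω)
    exact Finset.single_le_sum (f := fun i => φ i ω ^ 2) (fun i _ => sq_nonneg _)
      (Finset.mem_range.2 n.lt_succ_self)
  have hφabs : ∀ n ω, |φ n ω| ≤ 1 := fun n ω => (sq_le_one_iff_abs_le_one _).1 (hφ1 n ω)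
  have hprod : ∀ n, MemLp (fun ω => φ n ω * ξ n ω) 2 P := fun n =>
    (hL2 n).of_le ((hφm n).mul (hξm n)).aestronglyMeasurable (ae_of_all _ fun ω => by
      rw [norm_mul, Real.norm_eq_abs (φ n ω)]
      exact mul_le_of_le_one_left (norm_nonneg _) (hφabs n ω))
  have hML2 : ∀ n, MemLp (M n) 2 P := fun n => memLp_finsetSum _ fun i _ => hprod i
  have hMad : ∀ n, Measurable[ℱ n] (M n) := fun n =>
    Finset.measurable_sum _ fun i hi =>
      ((hφ i).mono (ℱ.mono (Finset.mem_range.1 hi).le) le_rfl).mul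
        ((hξ i).mono (ℱ.mono (Finset.mem_range.1 hi)) le_rfl)
  have hcross : ∀ n, ∫ ω, M n ω * φ n ω * ξ n ω ∂P = 0 := by
    intro n
    have hi : IndepFun (ξ n) (fun ω => M n ω * φ n ω) P :=
      indepFun_of_indep_comap (hind n) ((hMad n).mul (hφ n))
    have := hi.symm.integral_mul_eq_mul_integral
      ((((hMad n).mul (hφ n)).mono (ℱ.le n) le_rfl).aestronglyMeasurable)
      (hξm n).aestronglyMeasurable
    rw [hmean, mul_zero] at this
    exact this
  have hsq : ∀ n, ∫ ω, φ n ω ^ 2 * ξ n ω ^ 2 ∂P = ∫ ω, φ n ω ^ 2 ∂P := by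
    intro n
    have hi : IndepFun (ξ n) (φ n) P := indepFun_of_indep_comap (hind n) (hφ n)
    have hi2 : IndepFun (fun ω => φ n ω ^ 2) (fun ω => ξ n ω ^ 2) P :=
      hi.symm.comp (measurable_id.pow_const 2) (measurable_id.pow_const 2)
    have := hi2.integral_mul_eq_mul_integral ((hφm n).pow_const 2).aestronglyMeasurable
      ((hξm n).pow_const 2).aestronglyMeasurable
    rw [hvar, mul_one] at this
    exact this
  have hφint : ∀ n, Integrable (fun ω => φ n ω ^ 2) P := fun n =>
    Integrable.of_bound ((hφm n).pow_const 2).aestronglyMeasurable 1 (ae_of_all _ fun ω => by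
      rw [Real.norm_eq_abs, abs_of_nonneg (sq_nonneg _)]
      exact hφ1 n ω)
  -- Orthogonality of the increments: the cross terms vanish because `ξ n` is centred and
  -- independent of `ℱ n`.
  have henergy : ∀ n, ∫ ω, M n ω ^ 2 ∂P = ∑ i ∈ Finset.range n, ∫ ω, φ i ω ^ 2 ∂P := by
    intro n
    induction n with
    | zero => simp [hM]
    | succ n ih =>
      have hexp : ∀ ω, M (n + 1) ω ^ 2
          = M n ω ^ 2 + 2 * (M n ω * φ n ω * ξ n ω) + φ n ω ^ 2 * ξ n ω ^ 2 := by
        intro ω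
        rw [hMsucc]
        ring
      have i1 : Integrable (fun ω => M n ω ^ 2) P := (hML2 n).integrable_sq
      have i2 : Integrable (fun ω => 2 * (M n ω * φ n ω * ξ n ω)) P := by
        refine Integrable.const_mul ?_ 2
        have := (hML2 n).integrable_mul (hprod n)
        refine this.congr (ae_of_all _ fun ω => ?_)
        simp [mul_assoc]
      have i3 : Integrable (fun ω => φ n ω ^ 2 * ξ n ω ^ 2) P := by
        have := (hprod n).integrable_sq
        simpa only [mul_pow] using this
      have i12 : Integrable (fun ω => M n ω ^ 2 + 2 * (M n ω * φ n ω * ξ n ω)) P := i1.add i2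
      simp only [hexp]
      rw [integral_add i12 i3, integral_add i1 i2, integral_const_mul, hcross, hsq, ih,
        Finset.sum_range_succ]
      ring
  have hmart : Martingale M ℱ P := by
    refine martingale_of_condExp_sub_eq_zero_nat (fun n => (hMad n).stronglyMeasurable)
      (fun n => (hML2 n).integrable one_le_two) fun n => ?_
    have hdiff : M (n + 1) - M n = φ n * ξ n := by
      ext ω
      simp [hMsucc]
    rw [hdiff]
    have h1 := condExp_mul_of_stronglyMeasurable_left (μ := P) (m := ℱ n)
      (hφ n).stronglyMeasurable ((hprod n).integrable one_le_two)
      ((hL2 n).integrable one_le_two)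
    have h2 := condExp_indep_eq (μ := P) (hξm n).comap_le (ℱ.le n)
      (comap_measurable (ξ n)).stronglyMeasurable (hind n)
    filter_upwards [h1, h2] with ω h1 h2
    rw [h1, Pi.mul_apply, h2, hmean, mul_zero, Pi.zero_apply]
  -- The `L¹` bound 2 comes from `|x| ≤ 1 + x²` and total energy at most 1.
  refine hmart.submartingale.exists_ae_tendsto_of_bdd (R := 2) fun n => ?_
  rw [eLpNorm_one_eq_lintegral_enorm,
    ← ofReal_integral_norm_eq_lintegral_enorm ((hML2 n).integrable one_le_two)]
  have h1 : ∫ ω, ‖M n ω‖ ∂P ≤ ∫ ω, (1 + M n ω ^ 2) ∂P := by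
    refine integral_mono ((hML2 n).integrable one_le_two).norm
      ((integrable_const 1).add (hML2 n).integrable_sq) fun ω => ?_
    simp only [Real.norm_eq_abs]
    nlinarith [sq_nonneg (|M n ω| - 1), sq_abs (M n ω), abs_nonneg (M n ω)]
  have h2 : ∫ ω, (1 + M n ω ^ 2) ∂P ≤ 2 := by
    rw [integral_add (integrable_const 1) (hML2 n).integrable_sq, henergy,
      ← integral_finsetSum _ fun i _ => hφint i]
    have : ∫ ω, ∑ i ∈ Finset.range n, φ i ω ^ 2 ∂P ≤ ∫ _, (1 : ℝ) ∂P :=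
      integral_mono (integrable_finsetSum _ fun i _ => hφint i) (integrable_const 1)
        fun ω => hsum n ω
    simp only [integral_const, probReal_univ, smul_eq_mul, mul_one] at this ⊢
    linarith
  rw [show ((2 : NNReal) : ENNReal) = ENNReal.ofReal 2 by simp]
  exact ENNReal.ofReal_le_ofReal (h1.trans h2)

end Martingale

/-- Kronecker's lemma for nondecreasing weights of at most linear growth. -/
theorem tendsto_weighted_sum_div {r x : ℕ → ℝ} {l K R : ℝ} (hr0 : ∀ n, 0 ≤ r n)
    (hr : Monotone r) (hrK : ∀ n : ℕ, r n ≤ K * n + R)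
    (hx : Tendsto (fun n => ∑ i ∈ Finset.range n, x i) atTop (𝓝 l)) :
    Tendsto (fun n : ℕ => (∑ i ∈ Finset.range n, r i * x i) / n) atTop (𝓝 0) := by
  -- Summation by parts is done with the partial sums recentred at their limit, so that `T` tends to
  -- 0.
  set T : ℕ → ℝ := fun n => ∑ i ∈ Finset.range n, x i - l with hT
  have hT0 : Tendsto T atTop (𝓝 0) := by simpa [hT] using hx.sub_const l
  have abel : ∀ n, ∑ i ∈ Finset.range n, r i * x i
      = r n * T n - r 0 * T 0 - ∑ i ∈ Finset.range n, (r (i + 1) - r i) * T (i + 1) := by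
    intro n
    induction n with
    | zero => simp
    | succ n ih =>
      have : x n = T (n + 1) - T n := by simp [hT, Finset.sum_range_succ]
      rw [Finset.sum_range_succ, Finset.sum_range_succ, ih, this]
      ring
  rw [Metric.tendsto_atTop]
  intro e he
  obtain ⟨D, hD0, hD⟩ : ∃ D, 0 < D ∧ ∀ n : ℕ, 1 ≤ n → r n ≤ D * n := by
    refine ⟨|K| + |R| + 1, by positivity, fun n hn => (hrK n).trans ?_⟩
    have hn' : (1 : ℝ) ≤ n := by exact_mod_cast hn
    nlinarith [mul_le_mul_of_nonneg_right (le_abs_self K) (n.cast_nonneg (α := ℝ)),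
      mul_le_mul_of_nonneg_left hn' (abs_nonneg R), le_abs_self R]
  -- Two terms of size `η * r n` each cost at most `(e/4) n`; the other `(e/2) n` absorbs the
  -- constants `|r 0 * T 0|` and `B`.
  set η := e / (4 * D) with hη
  have hη0 : 0 < η := by positivity
  obtain ⟨N, hN⟩ := Metric.tendsto_atTop.1 hT0 η hη0
  have hN' : ∀ n, N ≤ n → |T n| ≤ η := fun n hn => by
    have := hN n hn
    rw [Real.dist_eq, sub_zero] at this
    exact this.le
  set B := ∑ i ∈ Finset.range N, |(r (i + 1) - r i) * T (i + 1)| with hB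
  have hB0 : 0 ≤ B := Finset.sum_nonneg fun i _ => abs_nonneg _
  have hsum : ∀ n, |∑ i ∈ Finset.range n, (r (i + 1) - r i) * T (i + 1)| ≤ B + η * r n := by
    intro n
    by_cases hn : n ≤ N
    · refine (Finset.abs_sum_le_sum_abs _ _).trans ?_
      have := Finset.sum_le_sum_of_subset_of_nonneg (Finset.range_subset_range.2 hn)
          fun i _ _ => abs_nonneg ((r (i + 1) - r i) * T (i + 1))
      have h2 := mul_nonneg hη0.le (hr0 n)
      linarith
    · obtain ⟨m, rfl⟩ := Nat.exists_eq_add_of_le (not_le.1 hn).le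
      clear hn
      induction m with
      | zero =>
        refine (Finset.abs_sum_le_sum_abs _ _).trans ?_
        have h2 := mul_nonneg hη0.le (hr0 (N + 0))
        simp only [add_zero] at h2 ⊢
        linarith
      | succ m ih =>
        rw [← add_assoc, Finset.sum_range_succ]
        refine (abs_add_le _ _).trans ?_
        rw [abs_mul, abs_of_nonneg (sub_nonneg.2 (hr (Nat.le_succ (N + m))))]
        have := mul_le_mul_of_nonneg_left (hN' (N + m + 1) (by omega))
          (sub_nonneg.2 (hr (Nat.le_succ (N + m))))
        simp only [Nat.succ_eq_add_one] at this ⊢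
        linarith
  have hlin : Tendsto (fun n : ℕ => (e / 2) * (n : ℝ)) atTop atTop :=
    tendsto_natCast_atTop_atTop.const_mul_atTop (by positivity)
  obtain ⟨N₂, hN₂⟩ := eventually_atTop.1 (hlin.eventually_gt_atTop (|r 0 * T 0| + B))
  refine ⟨max (max N N₂) 1, fun n hn => ?_⟩
  have hn1 : 1 ≤ n := (le_max_right _ _).trans hn
  have hnN : N ≤ n := ((le_max_left _ _).trans (le_max_left _ _)).trans hn
  have hnN2 : N₂ ≤ n := ((le_max_right _ _).trans (le_max_left _ _)).trans hn
  have hnpos : (0 : ℝ) < n := by exact_mod_cast hn1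
  rw [Real.dist_eq, sub_zero, abs_div, abs_of_pos hnpos, div_lt_iff₀ hnpos, abel]
  have h1 := hsum n
  have h2 : |r n * T n| ≤ η * r n := by
    rw [abs_mul, abs_of_nonneg (hr0 n), mul_comm]
    exact mul_le_mul_of_nonneg_right (hN' n hnN) (hr0 n)
  have h3 : η * r n ≤ e / 4 * n := by
    refine (mul_le_mul_of_nonneg_left (hD n hn1) hη0.le).trans (le_of_eq ?_)
    rw [hη]
    field_simp
  have h4 := hN₂ n hnN2
  have h5 := abs_sub (r n * T n - r 0 * T 0)
    (∑ i ∈ Finset.range n, (r (i + 1) - r i) * T (i + 1))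
  have h6 := abs_sub (r n * T n) (r 0 * T 0)
  linarith

section Martingale

variable {Ω : Type*} {m0 : MeasurableSpace Ω} {P : Measure Ω} [IsProbabilityMeasure P]
  {ℱ : Filtration ℕ m0} {ξ : ℕ → Ω → ℝ}

/-- Strong law for martingale transforms: on the event where the energy of the predictable
weights grows at most linearly, the transform is `o(n)`. -/
theorem ae_tendsto_sum_mul_noise_div (hξ : ∀ n, Measurable[ℱ (n + 1)] (ξ n))
    (hind : ∀ n, Indep (MeasurableSpace.comap (ξ n) inferInstance) (ℱ n) P)
    (hL2 : ∀ n, MemLp (ξ n) 2 P) (hmean : ∀ n, ∫ ω, ξ n ω ∂P = 0)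
    (hvar : ∀ n, ∫ ω, ξ n ω ^ 2 ∂P = 1)
    {φ : ℕ → Ω → ℝ} (hφ : ∀ n, Measurable[ℱ n] (φ n)) :
    ∀ᵐ ω ∂P, ∀ K, LinearGrowth K (fun i => φ i ω ^ 2) →
      Tendsto (fun n : ℕ => (∑ i ∈ Finset.range n, φ i ω * ξ i ω) / n) atTop (𝓝 0) := by
  -- Self-normalization: `S n` includes `φ n` and is still `ℱ n`-measurable. Since `φ_n²/S_n² ≤
  -- 1/S_{n-1} - 1/S_n`, the weights `φ/S` have energy at most 1 on every path. Kronecker's lemma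
  -- with weights `S` then undoes the normalization.
  set S : ℕ → Ω → ℝ := fun n ω => 1 + ∑ i ∈ Finset.range (n + 1), φ i ω ^ 2 with hS
  have hS1 : ∀ n ω, 1 ≤ S n ω := fun n ω => by
    have := Finset.sum_nonneg fun i (_ : i ∈ Finset.range (n + 1)) => sq_nonneg (φ i ω)
    simp only [hS]
    linarith
  have hSm : ∀ n, Measurable[ℱ n] (S n) := fun n =>
    Measurable.const_add (Finset.measurable_sum _ fun i hi =>
      ((hφ i).mono (ℱ.mono (by have := Finset.mem_range.1 hi; omega)) le_rfl).pow_const 2) 1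
  have hsum : ∀ n ω, ∑ i ∈ Finset.range n, (φ i ω / S i ω) ^ 2 ≤ 1 := by
    intro n ω
    have key : ∑ i ∈ Finset.range n, (φ i ω / S i ω) ^ 2
        ≤ 1 - 1 / (1 + ∑ i ∈ Finset.range n, φ i ω ^ 2) := by
      induction n with
      | zero => simp
      | succ n ih =>
        rw [Finset.sum_range_succ]
        set A := 1 + ∑ i ∈ Finset.range n, φ i ω ^ 2 with hA
        have hA1 : 1 ≤ A := by
          have := Finset.sum_nonneg fun i (_ : i ∈ Finset.range n) => sq_nonneg (φ i ω)
          linarith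
        have hSA : S n ω = A + φ n ω ^ 2 := by
          simp only [hS, hA, Finset.sum_range_succ]
          ring
        have hSA' : 1 + ∑ i ∈ Finset.range (n + 1), φ i ω ^ 2 = A + φ n ω ^ 2 := hSA
        rw [hSA', hSA]
        have hpos : 0 < A := by linarith
        have hpos2 : 0 < A + φ n ω ^ 2 := by positivity
        have h1 : 1 / A - 1 / (A + φ n ω ^ 2) - (φ n ω / (A + φ n ω ^ 2)) ^ 2
            = (φ n ω ^ 2) ^ 2 / (A * (A + φ n ω ^ 2) ^ 2) := by
          field_simp
          ring
        have h2 : 0 ≤ (φ n ω ^ 2) ^ 2 / (A * (A + φ n ω ^ 2) ^ 2) := by positivity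
        linarith
    refine key.trans (sub_le_self _ ?_)
    have := Finset.sum_nonneg fun i (_ : i ∈ Finset.range n) => sq_nonneg (φ i ω)
    positivity
  filter_upwards [ae_tendsto_sum_mul_noise hξ hind hL2 hmean hvar
    (φ := fun n ω => φ n ω / S n ω) (fun n => (hφ n).div (hSm n)) hsum] with ω hω K hK
  obtain ⟨l, hl⟩ := hω
  obtain ⟨R, hR⟩ := hK
  have := tendsto_weighted_sum_div (r := fun n => S n ω) (K := K) (R := 1 + K + R)
    (fun n => zero_le_one.trans (hS1 n ω)) ?_ ?_ hl
  · refine this.congr fun n => ?_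
    congr 1
    refine Finset.sum_congr rfl fun i _ => ?_
    have : S i ω ≠ 0 := (zero_lt_one.trans_le (hS1 i ω)).ne'
    field_simp
  · refine monotone_nat_of_le_succ fun n => ?_
    simp only [hS]
    rw [Finset.sum_range_succ _ (n + 1)]
    linarith [sq_nonneg (φ (n + 1) ω)]
  · intro n
    have := hR (n + 1)
    simp only [hS]
    push_cast at this
    linarith

end Martingale

end QuantARX

/-! ### Rayleigh bounds and the normal equations of ridge regression -/

namespace QuantARX

section Rayleigh

variable {ι : Type*} [Fintype ι] [DecidableEq ι] {A : Matrix ι ι ℝ}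

theorem dotProduct_self_eq_sum_eigenvectors (hA : A.IsHermitian) (x : ι → ℝ) :
    x ⬝ᵥ x = ∑ i, ((hA.eigenvectorBasis i).ofLp ⬝ᵥ x) ^ 2 := by
  have := hA.eigenvectorBasis.sum_sq_norm_inner_right (WithLp.toLp 2 x)
  rw [EuclideanSpace.real_norm_sq_eq] at this
  simp only [EuclideanSpace.inner_eq_star_dotProduct, star_trivial, Real.norm_eq_abs, sq_abs] at this
  calc x ⬝ᵥ x = ∑ i, x i ^ 2 := by simp [dotProduct, sq]
    _ = _ := by
      rw [← this]
      exact Finset.sum_congr rfl fun i _ => by rw [dotProduct_comm]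

theorem dotProduct_mulVec_eq_sum_eigenvalues (hA : A.IsHermitian) (x : ι → ℝ) :
    x ⬝ᵥ A.mulVec x = ∑ i, hA.eigenvalues i * ((hA.eigenvectorBasis i).ofLp ⬝ᵥ x) ^ 2 := by
  have := hA.eigenvectorBasis.sum_inner_mul_inner (WithLp.toLp 2 x) (WithLp.toLp 2 (A.mulVec x))
  simp only [EuclideanSpace.inner_eq_star_dotProduct, star_trivial] at this
  rw [dotProduct_comm, ← this]
  refine Finset.sum_congr rfl fun i _ => ?_
  have hsymm : A.mulVec x ⬝ᵥ (hA.eigenvectorBasis i).ofLp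
      = x ⬝ᵥ A.mulVec (hA.eigenvectorBasis i).ofLp := by
    rw [Matrix.dotProduct_mulVec, ← Matrix.mulVec_transpose, ← Matrix.conjTranspose_eq_transpose_of_trivial,
      hA.eq]
  rw [hsymm, hA.mulVec_eigenvectorBasis, dotProduct_smul, dotProduct_comm x, smul_eq_mul]
  ring

theorem iInf_eigenvalues_mul_le (hA : A.IsHermitian) (x : ι → ℝ) :
    (⨅ i, hA.eigenvalues i) * (x ⬝ᵥ x) ≤ x ⬝ᵥ A.mulVec x := by
  rw [dotProduct_mulVec_eq_sum_eigenvalues hA, dotProduct_self_eq_sum_eigenvectors hA,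
    Finset.mul_sum]
  exact Finset.sum_le_sum fun i _ =>
    mul_le_mul_of_nonneg_right (ciInf_le (Set.finite_range _).bddBelow i) (sq_nonneg _)

theorem le_iSup_eigenvalues_mul (hA : A.IsHermitian) (x : ι → ℝ) :
    x ⬝ᵥ A.mulVec x ≤ (⨆ i, hA.eigenvalues i) * (x ⬝ᵥ x) := by
  rw [dotProduct_mulVec_eq_sum_eigenvalues hA, dotProduct_self_eq_sum_eigenvectors hA,
    Finset.mul_sum]
  exact Finset.sum_le_sum fun i _ =>
    mul_le_mul_of_nonneg_right (le_ciSup (Set.finite_range _).bddAbove i) (sq_nonneg _)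

theorem iSup_eigenvalues_le_trace (hA : A.PosSemidef) :
    ⨆ i, hA.1.eigenvalues i ≤ A.trace := by
  refine Real.iSup_le (fun i => ?_) hA.trace_nonneg
  rw [hA.1.trace_eq_sum_eigenvalues]
  exact Finset.single_le_sum (f := fun i => hA.1.eigenvalues i)
    (fun i _ => hA.eigenvalues_nonneg i) (Finset.mem_univ i)

end Rayleigh

section Ridge

variable (s u : ℕ → ℝ) (p q n : ℕ)

theorem dotProduct_infoMatrix_mulVec (x z : Fin p ⊕ Fin q → ℝ) :
    x ⬝ᵥ (infoMatrix s u p q n).mulVec z = x ⬝ᵥ z +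
      ∑ i ∈ Finset.range n, (x ⬝ᵥ regressor s u p q i) * (z ⬝ᵥ regressor s u p q i) := by
  rw [infoMatrix, Matrix.add_mulVec, Matrix.one_mulVec, dotProduct_add, Matrix.sum_mulVec,
    dotProduct_sum]
  congr 1
  refine Finset.sum_congr rfl fun i _ => ?_
  rw [Matrix.vecMulVec_mulVec, dotProduct_comm z]
  simp [mul_comm]

theorem infoMatrix_posDef : (infoMatrix s u p q n).PosDef := by
  refine Matrix.PosDef.of_dotProduct_mulVec_pos (infoMatrix_isHermitian s u p q n) fun x hx => ?_
  rw [star_trivial, dotProduct_infoMatrix_mulVec]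
  have h1 : 0 < x ⬝ᵥ x := by
    have := Matrix.dotProduct_star_self_pos_iff.2 hx
    simpa using this
  have h2 := Finset.sum_nonneg fun i (_ : i ∈ Finset.range n) =>
    mul_self_nonneg (x ⬝ᵥ regressor s u p q i)
  linarith

/-- The normal equations `P_n⁻¹ θ_n = ∑ ψ_i s_{i+1}`, tested against a direction `d`. -/
theorem thetaHat_normal_eq (d : Fin p ⊕ Fin q → ℝ) :
    d ⬝ᵥ thetaHat s u p q n + ∑ i ∈ Finset.range n,
        (d ⬝ᵥ regressor s u p q i) * (thetaHat s u p q n ⬝ᵥ regressor s u p q i)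
      = ∑ i ∈ Finset.range n, s (i + 1) * (d ⬝ᵥ regressor s u p q i) := by
  rw [← dotProduct_infoMatrix_mulVec, thetaHat, Matrix.mulVec_mulVec,
    Matrix.mul_nonsing_inv _ ((Matrix.isUnit_iff_isUnit_det _).1 (infoMatrix_posDef s u p q n).isUnit),
    Matrix.one_mulVec, dotProduct_sum]
  simp

/-- The estimate minimizes the penalized residual sum of squares. -/
theorem sigma_le (x : Fin p ⊕ Fin q → ℝ) :
    sigma s u p q n ≤
      ∑ i ∈ Finset.range n, (s (i + 1) - x ⬝ᵥ regressor s u p q i) ^ 2 + x ⬝ᵥ x := by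
  obtain ⟨d, rfl⟩ : ∃ d, x = thetaHat s u p q n + d := ⟨x - thetaHat s u p q n, by abel⟩
  set θ := thetaHat s u p q n with hθ
  have hn := thetaHat_normal_eq s u p q n d
  rw [← hθ] at hn
  -- By the normal equations, the term linear in `d` is `-2 d·θ`, which cancels against the cross
  -- term of `‖θ + d‖²`; what is left over is nonnegative.
  have hexp : ∑ i ∈ Finset.range n, (s (i + 1) - (θ + d) ⬝ᵥ regressor s u p q i) ^ 2
      = sigma s u p q n - 2 * (∑ i ∈ Finset.range n, s (i + 1) * (d ⬝ᵥ regressor s u p q i)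
        - ∑ i ∈ Finset.range n,
        (d ⬝ᵥ regressor s u p q i) * (θ ⬝ᵥ regressor s u p q i))
        + ∑ i ∈ Finset.range n, (d ⬝ᵥ regressor s u p q i) ^ 2 := by
    rw [sigma, ← Finset.sum_sub_distrib, Finset.mul_sum, ← Finset.sum_sub_distrib,
      ← Finset.sum_add_distrib]
    refine Finset.sum_congr rfl fun i _ => ?_
    rw [add_dotProduct, ← hθ]
    ring
  have h1 : 0 ≤ ∑ i ∈ Finset.range n, (d ⬝ᵥ regressor s u p q i) ^ 2 :=
    Finset.sum_nonneg fun i _ => sq_nonneg _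
  have h2 : (θ + d) ⬝ᵥ (θ + d) = θ ⬝ᵥ θ + 2 * (d ⬝ᵥ θ) + d ⬝ᵥ d := by
    rw [add_dotProduct, dotProduct_add, dotProduct_add, dotProduct_comm θ d]
    ring
  have h3 : 0 ≤ θ ⬝ᵥ θ := by simpa using dotProduct_star_self_nonneg θ
  have h4 : 0 ≤ d ⬝ᵥ d := by simpa using dotProduct_star_self_nonneg d
  rw [hexp, h2]
  linarith

/-- Testing the normal equations with `d = θ` and using `2st ≤ s² + t²` allows the quadratic term to
be absorbed on the left. Combined with a lower bound on `lambdaMin`, this keeps the estimates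
bounded. -/
theorem thetaHat_infoMatrix_le :
    thetaHat s u p q n ⬝ᵥ (infoMatrix s u p q n).mulVec (thetaHat s u p q n)
      ≤ ∑ i ∈ Finset.range n, s (i + 1) ^ 2 := by
  set θ := thetaHat s u p q n with hθ
  have hn := thetaHat_normal_eq s u p q n θ
  rw [← hθ] at hn
  rw [dotProduct_infoMatrix_mulVec]
  have h1 : ∑ i ∈ Finset.range n, s (i + 1) * (θ ⬝ᵥ regressor s u p q i)
      ≤ (∑ i ∈ Finset.range n, s (i + 1) ^ 2 + ∑ i ∈ Finset.range n,
        (θ ⬝ᵥ regressor s u p q i) * (θ ⬝ᵥ regressor s u p q i)) / 2 := by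
    rw [← Finset.sum_add_distrib, Finset.sum_div]
    refine Finset.sum_le_sum fun i _ => ?_
    nlinarith [sq_nonneg (s (i + 1) - θ ⬝ᵥ regressor s u p q i)]
  have h3 : 0 ≤ θ ⬝ᵥ θ := by simpa using dotProduct_star_self_nonneg θ
  linarith

theorem lambdaMin_mul_le (x : Fin p ⊕ Fin q → ℝ) :
    lambdaMin s u p q n * (x ⬝ᵥ x) ≤
      x ⬝ᵥ x + ∑ i ∈ Finset.range (n + 1), (x ⬝ᵥ regressor s u p q i) ^ 2 := by
  have := iInf_eigenvalues_mul_le (infoMatrix_isHermitian s u p q (n + 1)) x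
  rw [dotProduct_infoMatrix_mulVec] at this
  simp only [← sq] at this
  exact this

theorem le_lambdaMax_mul (x : Fin p ⊕ Fin q → ℝ) :
    x ⬝ᵥ x + ∑ i ∈ Finset.range (n + 1), (x ⬝ᵥ regressor s u p q i) ^ 2 ≤
      lambdaMax s u p q n * (x ⬝ᵥ x) := by
  have := le_iSup_eigenvalues_mul (infoMatrix_isHermitian s u p q (n + 1)) x
  rw [dotProduct_infoMatrix_mulVec] at this
  simp only [← sq] at this
  exact this

theorem lambdaMin_mul_thetaHat_le :
    lambdaMin s u p q n * (thetaHat s u p q (n + 1) ⬝ᵥ thetaHat s u p q (n + 1))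
      ≤ ∑ i ∈ Finset.range (n + 1), s (i + 1) ^ 2 :=
  (iInf_eigenvalues_mul_le (infoMatrix_isHermitian s u p q (n + 1)) _).trans
    (thetaHat_infoMatrix_le s u p q (n + 1))

/-- The largest eigenvalue is at most the trace, which depends only on the energies of the regressor
coordinates. -/
theorem lambdaMax_le :
    lambdaMax s u p q n ≤ (p + q : ℝ) +
      ∑ k, ∑ i ∈ Finset.range (n + 1), regressor s u p q i k ^ 2 := by
  refine (iSup_eigenvalues_le_trace (infoMatrix_posDef s u p q (n + 1)).posSemidef).trans
    (le_of_eq ?_)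
  rw [infoMatrix, Matrix.trace_add, Matrix.trace_one, Matrix.trace_sum, Finset.sum_comm]
  simp [Matrix.trace_vecMulVec, dotProduct, sq]

end Ridge

end QuantARX

/-! ### The regression model of the quantized output, and zero padding -/

namespace QuantARX

theorem sum_fin_dite_lt {q q₀ : ℕ} (h : q ≤ q₀) (F : Fin q → ℝ) :
    ∑ k : Fin q₀, (if hk : (k : ℕ) < q then F ⟨k, hk⟩ else 0) = ∑ k, F k := by
  obtain ⟨m, rfl⟩ := Nat.exists_eq_add_of_le h
  rw [Fin.sum_univ_add]
  simp

/-- The right side is free of `p` and `q`: all models containing the true one share the same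
equation error. -/
theorem thetaBar_dotProduct_regressor {p₀ q₀ p q : ℕ} (hp : p₀ ≤ p) (hq : q₀ ≤ q) (a b : ℕ → ℝ)
    (s u : ℕ → ℝ) (i : ℕ) :
    thetaBar p₀ q₀ a b p q ⬝ᵥ regressor s u p q i =
      ∑ k ∈ Finset.range q₀, b (k + 1) * fromOne u ((i : ℤ) - k)
        - ∑ k ∈ Finset.range p₀, a (k + 1) * fromOne s ((i : ℤ) - k) := by
  have trunc : ∀ {m M : ℕ}, m ≤ M → ∀ α x : ℕ → ℝ,
      ∑ k : Fin M, (if (k : ℕ) + 1 ≤ m then α k else 0) * x k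
        = ∑ k ∈ Finset.range m, α k * x k := by
    intro m M hm α x
    rw [Fin.sum_univ_eq_sum_range (fun k => (if k + 1 ≤ m then α k else 0) * x k) M]
    obtain ⟨d, rfl⟩ := Nat.exists_eq_add_of_le hm
    rw [Finset.sum_range_add, Finset.sum_eq_zero (s := Finset.range d), add_zero]
    · refine Finset.sum_congr rfl fun k hk => ?_
      rw [if_pos (Nat.succ_le_of_lt (Finset.mem_range.1 hk))]
    · intro k _
      rw [if_neg (by omega), zero_mul]
  simp only [dotProduct, thetaBar, regressor, Fintype.sum_sum_type, Sum.elim_inl, Sum.elim_inr]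
  rw [trunc hp (fun k => -a (k + 1)) (fun k => fromOne s ((i : ℤ) - k)),
    trunc hq (fun k => b (k + 1)) (fun k => fromOne u ((i : ℤ) - k))]
  simp only [neg_mul, Finset.sum_neg_distrib]
  ring

theorem abs_quantize_sub_le {ε : ℝ} (hε : 0 < ε) (x : ℝ) : |quantize ε x - x| ≤ ε / 2 := by
  have h1 := Int.floor_le (x / ε + 1 / 2)
  have h2 := Int.lt_floor_add_one (x / ε + 1 / 2)
  have hx : x = ε * (x / ε) := by field_simp
  rw [quantize, abs_le]
  constructor <;> nlinarith

/-- The quantization contributes a bounded equation error to the linear regression model of the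
quantized output. -/
theorem abs_regression_error_le {p₀ q₀ p : ℕ} {a b y u w s : ℕ → ℝ} {ε c : ℝ} (hε : 0 < ε)
    (hARX : IsARXPath p₀ q₀ a b y u w) (hs : ∀ n, s n = quantize ε (y n))
    (hac : ∀ i, 1 ≤ i → i ≤ p₀ → |a i| ≤ c) (hp : p₀ ≤ p) {i : ℕ}
    (hip : p₀ ≤ i) (hiq : q₀ ≤ i) :
    |s (i + 1) - thetaBar p₀ q₀ a b p q₀ ⬝ᵥ regressor s u p q₀ i - w (i + 1)|
      ≤ (1 + p₀ * c) * ε / 2 := by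
  have hrec := hARX i
  have reindex : ∀ (m : ℕ) (f : ℕ → ℝ), ∑ j ∈ Finset.Icc 1 m, f j
      = ∑ k ∈ Finset.range m, f (k + 1) := by
    intro m f
    rw [Finset.range_eq_Ico, Finset.sum_Ico_add' f 0 m 1]
    rfl
  -- For `i ≥ max p₀ q₀` all times involved are at least 1, so the two conventions for early times
  -- agree.
  have hval : ∀ (x : ℕ → ℝ) (m : ℕ), m ≤ i → ∀ k ∈ Finset.range m,
      fromOne x ((i : ℤ) - k) = x (i - k) ∧
        fromZero x ((i : ℤ) + 1 - ((k + 1 : ℕ) : ℤ)) = x (i - k) := by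
    intro x m hm k hk
    have hk := Finset.mem_range.1 hk
    have h1 : ((i : ℤ) - k).toNat = i - k := by omega
    have h2 : ((i : ℤ) + 1 - ((k + 1 : ℕ) : ℤ)).toNat = i - k := by omega
    constructor
    · rw [fromOne, if_pos (by omega), h1]
    · rw [fromZero, if_pos (by omega), h2]
  rw [reindex, reindex, Finset.sum_congr rfl fun k hk => by rw [(hval y p₀ hip k hk).2],
    Finset.sum_congr (s₁ := Finset.range q₀) rfl fun k hk => by rw [(hval u q₀ hiq k hk).2]] at hrec
  rw [thetaBar_dotProduct_regressor hp le_rfl,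
    Finset.sum_congr (s₁ := Finset.range p₀) rfl fun k hk => by rw [(hval s p₀ hip k hk).1],
    Finset.sum_congr (s₁ := Finset.range q₀) rfl fun k hk => by rw [(hval u q₀ hiq k hk).1]]
  have hq : ∀ n, |s n - y n| ≤ ε / 2 := fun n => by
    rw [hs]
    exact abs_quantize_sub_le hε _
  have hsum : |∑ k ∈ Finset.range p₀, a (k + 1) * (s (i - k) - y (i - k))|
      ≤ p₀ * (c * (ε / 2)) := by
    refine (Finset.abs_sum_le_sum_abs _ _).trans ?_
    refine (Finset.sum_le_card_nsmul _ _ (c * (ε / 2)) fun k hk => ?_).trans ?_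
    · rw [abs_mul]
      have hk := Finset.mem_range.1 hk
      have := hac (k + 1) (by omega) (by omega)
      exact mul_le_mul this (hq _) (abs_nonneg _) ((abs_nonneg _).trans this)
    · rw [Finset.card_range, nsmul_eq_mul]
  simp only [mul_sub, Finset.sum_sub_distrib] at hsum
  have h0 := hq (i + 1)
  rw [abs_le] at hsum h0 ⊢
  constructor <;> linarith [hsum.1, hsum.2, h0.1, h0.2]

section Padding

variable (p₀ q₀ : ℕ) (a b s u : ℕ → ℝ) (p q n : ℕ)

/-- The difference between the true parameter and the zero-padded estimate. -/
noncomputable def paddedError : Fin p ⊕ Fin q₀ → ℝ :=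
  thetaBar p₀ q₀ a b p q₀ - paddedEstimate s u p q₀ q n

variable {q₀ q}

theorem paddedEstimate_dotProduct_regressor (hq : q ≤ q₀) (i : ℕ) :
    paddedEstimate s u p q₀ q n ⬝ᵥ regressor s u p q₀ i
      = thetaHat s u p q n ⬝ᵥ regressor s u p q i := by
  simp only [dotProduct, paddedEstimate, regressor, Fintype.sum_sum_type, Sum.elim_inl,
    Sum.elim_inr]
  congr 1
  rw [← sum_fin_dite_lt hq]
  refine Finset.sum_congr rfl fun k _ => ?_
  split_ifs <;> simp

theorem paddedEstimate_dotProduct_self (hq : q ≤ q₀) :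
    paddedEstimate s u p q₀ q n ⬝ᵥ paddedEstimate s u p q₀ q n
      = thetaHat s u p q n ⬝ᵥ thetaHat s u p q n := by
  simp only [dotProduct, paddedEstimate, Fintype.sum_sum_type, Sum.elim_inl, Sum.elim_inr]
  congr 1
  rw [← sum_fin_dite_lt hq]
  refine Finset.sum_congr rfl fun k _ => ?_
  split_ifs <;> simp

theorem sq_errorNorm :
    errorNorm p₀ q₀ a b s u p q n ^ 2
      = paddedError p₀ q₀ a b s u p q n ⬝ᵥ paddedError p₀ q₀ a b s u p q n := by
  rw [errorNorm, EuclideanSpace.real_norm_sq_eq]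
  simp [dotProduct, sq, paddedError]

/-- The last coordinate of the padded estimate is zero, so the error there is exactly `b q₀`. This
is what an order that is too small cannot avoid. -/
theorem sq_le_paddedError (hq : q < q₀) :
    b q₀ ^ 2 ≤ paddedError p₀ q₀ a b s u p q n ⬝ᵥ paddedError p₀ q₀ a b s u p q n := by
  have hlt : q₀ - 1 < q₀ := by omega
  have hval : paddedError p₀ q₀ a b s u p q n (Sum.inr ⟨q₀ - 1, hlt⟩) = b q₀ := by
    have h1 : q₀ - 1 + 1 = q₀ := by omega
    have h2 : ¬ q₀ - 1 < q := by omega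
    simp [paddedError, thetaBar, paddedEstimate, h1, h2]
  have := Finset.single_le_sum (f := fun k => paddedError p₀ q₀ a b s u p q n k
      * paddedError p₀ q₀ a b s u p q n k) (fun k _ => mul_self_nonneg _)
      (Finset.mem_univ (Sum.inr ⟨q₀ - 1, hlt⟩))
  rw [hval, ← sq] at this
  exact this

theorem sub_dotProduct_self_le {ι : Type*} [Fintype ι] (x z : ι → ℝ) :
    (x - z) ⬝ᵥ (x - z) ≤ 2 * (x ⬝ᵥ x) + 2 * (z ⬝ᵥ z) := by
  simp only [dotProduct, Finset.mul_sum, ← Finset.sum_add_distrib, Pi.sub_apply]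
  exact Finset.sum_le_sum fun i _ => by nlinarith [sq_nonneg (x i + z i)]

end Padding

/-- Persistent excitation and mean-square bounded outputs give bounded estimates. -/
theorem eventually_thetaHat_le {s u : ℕ → ℝ} {p q : ℕ} {c₂ C : ℝ} (hc₂ : 0 < c₂)
    (hPE : ∀ᶠ n : ℕ in atTop, c₂ * ((n : ℝ) + 1) ≤ lambdaMin s u p q n)
    (hs : ∀ᶠ n : ℕ in atTop, ∑ i ∈ Finset.range n, s (i + 1) ^ 2 ≤ C * n) :
    ∀ᶠ n in atTop, thetaHat s u p q n ⬝ᵥ thetaHat s u p q n ≤ C / c₂ := by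
  -- `lambdaMin` at `n` belongs to `P_{n+1}⁻¹`, hence the shift by one.
  filter_upwards [(tendsto_sub_atTop_nat 1).eventually hPE, hs, eventually_ge_atTop 1]
    with n hmin hsum hn
  obtain ⟨m, rfl⟩ := Nat.exists_eq_add_of_le' hn
  rw [Nat.add_sub_cancel] at hmin
  push_cast at hsum
  have hpos : (0 : ℝ) < (m : ℝ) + 1 := by positivity
  have h0 : 0 ≤ thetaHat s u p q (m + 1) ⬝ᵥ thetaHat s u p q (m + 1) := by
    simpa using dotProduct_star_self_nonneg (thetaHat s u p q (m + 1))
  have h1 := (mul_le_mul_of_nonneg_right hmin h0).trans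
    ((lambdaMin_mul_thetaHat_le s u p q m).trans hsum)
  rw [le_div_iff₀ hc₂]
  refine le_of_mul_le_mul_right ?_ hpos
  linarith

section Noise

variable {s u w : ℕ → ℝ} {p q : ℕ}

/-- In the application `x n` depends on the data up to time `n`, so the sum is not a martingale
transform. Since `x n` does not depend on `i`, its finitely many bounded coordinates can be pulled
out of the sum. -/
theorem tendsto_sum_dotProduct_noise_div {C : ℝ} {x : ℕ → Fin p ⊕ Fin q → ℝ}
    (hx : ∀ᶠ n in atTop, x n ⬝ᵥ x n ≤ C)
    (hnoise : ∀ k, Tendsto (fun n : ℕ => (∑ i ∈ Finset.range n, regressor s u p q i k * w (i + 1)) / n)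
      atTop (𝓝 0)) :
    Tendsto (fun n : ℕ => (∑ i ∈ Finset.range n, (x n ⬝ᵥ regressor s u p q i) * w (i + 1)) / n)
      atTop (𝓝 0) := by
  have hlim : Tendsto (fun n : ℕ => ∑ k, (C + 1) *
      |(∑ i ∈ Finset.range n, regressor s u p q i k * w (i + 1)) / n|) atTop (𝓝 0) := by
    have := tendsto_finsetSum (Finset.univ : Finset (Fin p ⊕ Fin q)) fun k _ =>
      ((hnoise k).abs.const_mul (C + 1))
    simpa using this
  refine squeeze_zero_norm' ?_ hlim
  filter_upwards [hx] with n hn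
  have hxk : ∀ k, |x n k| ≤ C + 1 := by
    intro k
    have h1 := Finset.single_le_sum (f := fun k => x n k * x n k) (fun k _ => mul_self_nonneg _)
      (Finset.mem_univ k)
    have h2 : x n k * x n k ≤ C := h1.trans hn
    nlinarith [sq_nonneg (|x n k| - 1), abs_mul_abs_self (x n k)]
  have hswap : (∑ i ∈ Finset.range n, (x n ⬝ᵥ regressor s u p q i) * w (i + 1)) / n
      = ∑ k, x n k * ((∑ i ∈ Finset.range n, regressor s u p q i k * w (i + 1)) / n) := by
    simp only [dotProduct, Finset.sum_mul, ← mul_div_assoc, ← Finset.sum_div, Finset.mul_sum]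
    rw [Finset.sum_comm]
    simp only [mul_assoc]
  rw [hswap, Real.norm_eq_abs]
  refine (Finset.abs_sum_le_sum_abs _ _).trans (Finset.sum_le_sum fun k _ => ?_)
  rw [abs_mul]
  exact mul_le_mul_of_nonneg_right (hxk k) (abs_nonneg _)

theorem eventually_abs_sum_le {f : ℕ → ℝ} (hf : Tendsto (fun n : ℕ => f n / n) atTop (𝓝 0))
    {e : ℝ} (he : 0 < e) : ∀ᶠ n : ℕ in atTop, |f n| ≤ e * n := by
  have h : ∀ᶠ n : ℕ in atTop, f n / n ∈ Metric.ball 0 e :=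
    hf.eventually (Metric.ball_mem_nhds 0 he)
  filter_upwards [h, eventually_gt_atTop 0] with n hn hn0
  have hpos : (0 : ℝ) < n := by exact_mod_cast hn0
  rw [Metric.mem_ball, Real.dist_eq, sub_zero, abs_div, abs_of_pos hpos] at hn
  exact ((div_lt_iff₀ hpos).1 hn).le

end Noise

end QuantARX

/-! ### Comparison of the criteria for different orders -/

namespace QuantARX

section Consistency

variable {p₀ q₀ ps qs : ℕ} {a b s u w : ℕ → ℝ} {c₂ C K : ℝ}

/-- The error of the linear regression model of the quantized output along a path. -/
noncomputable def modelError (p₀ q₀ : ℕ) (a b s u : ℕ → ℝ) (p i : ℕ) : ℝ :=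
  s (i + 1) - thetaBar p₀ q₀ a b p q₀ ⬝ᵥ regressor s u p q₀ i

/-- With `m = w + η` the model error and `f = x·ψ` the prediction error, `(m + f)² = m² + 2fw + (f +
η)² - η²`. Completing the square absorbs the cross term `fη`, so no upper bound on `∑ f²` is needed.
-/
theorem eventually_sum_sq_le_sigma (hp₀ : p₀ ≤ ps) (hc₂ : 0 < c₂) {q : ℕ} (hq : q₀ ≤ q)
    (hη : ∀ᶠ n : ℕ in atTop,
      ∑ i ∈ Finset.range n, (modelError p₀ q₀ a b s u ps i - w (i + 1)) ^ 2 ≤ K * n)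
    (hnoise : ∀ k, Tendsto
      (fun n : ℕ => (∑ i ∈ Finset.range n, regressor s u ps q i k * w (i + 1)) / n) atTop (𝓝 0))
    (hs : ∀ᶠ n : ℕ in atTop, ∑ i ∈ Finset.range n, s (i + 1) ^ 2 ≤ C * n)
    (hPE : ∀ᶠ n : ℕ in atTop, c₂ * ((n : ℝ) + 1) ≤ lambdaMin s u ps q n)
    {e : ℝ} (he : 0 < e) :
    ∀ᶠ n : ℕ in atTop, ∑ i ∈ Finset.range n, modelError p₀ q₀ a b s u ps i ^ 2
      ≤ sigma s u ps q n + (K + e) * n := by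
  set x : ℕ → Fin ps ⊕ Fin q → ℝ :=
    fun n => thetaBar p₀ q₀ a b ps q - thetaHat s u ps q n with hx
  have hxb : ∀ᶠ n in atTop, x n ⬝ᵥ x n ≤
      2 * (thetaBar p₀ q₀ a b ps q ⬝ᵥ thetaBar p₀ q₀ a b ps q) + 2 * (C / c₂) := by
    filter_upwards [eventually_thetaHat_le hc₂ hPE hs] with n hn
    exact (sub_dotProduct_self_le _ _).trans (by linarith)
  filter_upwards [hη, eventually_abs_sum_le (tendsto_sum_dotProduct_noise_div hxb hnoise)
    (half_pos he)] with n h1 h2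
  have h3 : sigma s u ps q n = ∑ i ∈ Finset.range n,
      (modelError p₀ q₀ a b s u ps i + x n ⬝ᵥ regressor s u ps q i) ^ 2 := by
    refine Finset.sum_congr rfl fun i _ => ?_
    rw [modelError, hx, sub_dotProduct, thetaBar_dotProduct_regressor hp₀ hq,
      thetaBar_dotProduct_regressor hp₀ le_rfl]
    ring
  have h4 : ∑ i ∈ Finset.range n, modelError p₀ q₀ a b s u ps i ^ 2 ≤
      sigma s u ps q n - 2 * ∑ i ∈ Finset.range n, (x n ⬝ᵥ regressor s u ps q i) * w (i + 1)
      + ∑ i ∈ Finset.range n, (modelError p₀ q₀ a b s u ps i - w (i + 1)) ^ 2 := by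
    rw [h3, Finset.mul_sum, ← Finset.sum_sub_distrib, ← Finset.sum_add_distrib]
    refine Finset.sum_le_sum fun i _ => ?_
    nlinarith [sq_nonneg (modelError p₀ q₀ a b s u ps i - w (i + 1)
      + x n ⬝ᵥ regressor s u ps q i)]
  have h5 := neg_abs_le (∑ i ∈ Finset.range n, (x n ⬝ᵥ regressor s u ps q i) * w (i + 1))
  linarith

/-- In `(m + f)² = m² + f² + 2fw + 2fη`, persistent excitation bounds `∑ f²` below, the noise term
is `o(n)`, and Cauchy–Schwarz with `∑ f² ≤ c₄ γ² n` handles `fη`. The loss `γ ^ 2` comes from the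
identity matrix in `P_n⁻¹`. -/
theorem eventually_le_sigma_of_lt (hc₂ : 0 < c₂) {q : ℕ} (hq : q < q₀) {c₄ γ : ℝ}
    (hc₄ : 0 < c₄) (hK : 0 ≤ K)
    (hη : ∀ᶠ n : ℕ in atTop,
      ∑ i ∈ Finset.range n, (modelError p₀ q₀ a b s u ps i - w (i + 1)) ^ 2 ≤ K * n)
    (hnoise : ∀ k, Tendsto
      (fun n : ℕ => (∑ i ∈ Finset.range n, regressor s u ps q₀ i k * w (i + 1)) / n) atTop (𝓝 0))
    (hPE : ∀ᶠ n : ℕ in atTop, c₂ * ((n : ℝ) + 1) ≤ lambdaMin s u ps q₀ n)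
    (hmax : ∀ᶠ n : ℕ in atTop, lambdaMax s u ps q₀ n ≤ c₄ * ((n : ℝ) + 1))
    (hγ : ∀ᶠ n : ℕ in atTop, errorNorm p₀ q₀ a b s u ps q n ≤ γ)
    {e : ℝ} (he : 0 < e) :
    ∀ᶠ n : ℕ in atTop, ∑ i ∈ Finset.range n, modelError p₀ q₀ a b s u ps i ^ 2
      + (b q₀ ^ 2 * c₂ - 2 * γ * Real.sqrt (c₄ * K) - e) * n - γ ^ 2 ≤ sigma s u ps q n := by
  set x : ℕ → Fin ps ⊕ Fin q₀ → ℝ := fun n => paddedError p₀ q₀ a b s u ps q n with hx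
  have hxb : ∀ᶠ n in atTop, x n ⬝ᵥ x n ≤ γ ^ 2 := by
    filter_upwards [hγ] with n hn
    rw [hx, ← sq_errorNorm]
    exact pow_le_pow_left₀ (norm_nonneg _) hn 2
  filter_upwards [hη, eventually_abs_sum_le (tendsto_sum_dotProduct_noise_div hxb hnoise)
    (half_pos he), hxb, hγ, (tendsto_sub_atTop_nat 1).eventually hPE,
    (tendsto_sub_atTop_nat 1).eventually hmax, eventually_ge_atTop 1]
    with n h1 h2 hxn hγn hmin hmax hn
  have hγ0 : 0 ≤ γ := (norm_nonneg _).trans hγn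
  have hb : b q₀ ^ 2 ≤ x n ⬝ᵥ x n := sq_le_paddedError p₀ a b s u ps n hq
  have h3 : sigma s u ps q n = ∑ i ∈ Finset.range n,
      (modelError p₀ q₀ a b s u ps i + x n ⬝ᵥ regressor s u ps q₀ i) ^ 2 := by
    refine Finset.sum_congr rfl fun i _ => ?_
    have hxr : x n ⬝ᵥ regressor s u ps q₀ i = thetaBar p₀ q₀ a b ps q₀ ⬝ᵥ regressor s u ps q₀ i
        - paddedEstimate s u ps q₀ q n ⬝ᵥ regressor s u ps q₀ i := sub_dotProduct _ _ _
    rw [modelError, hxr, paddedEstimate_dotProduct_regressor _ _ _ _ hq.le]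
    ring
  set D := ∑ i ∈ Finset.range n, (x n ⬝ᵥ regressor s u ps q₀ i) ^ 2 with hD
  set E := ∑ i ∈ Finset.range n, (x n ⬝ᵥ regressor s u ps q₀ i)
    * (modelError p₀ q₀ a b s u ps i - w (i + 1)) with hE
  have h4 : sigma s u ps q n = ∑ i ∈ Finset.range n, modelError p₀ q₀ a b s u ps i ^ 2 + D
      + 2 * ∑ i ∈ Finset.range n, (x n ⬝ᵥ regressor s u ps q₀ i) * w (i + 1) + 2 * E := by
    rw [h3, hD, hE, Finset.mul_sum, Finset.mul_sum, ← Finset.sum_add_distrib,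
      ← Finset.sum_add_distrib, ← Finset.sum_add_distrib]
    exact Finset.sum_congr rfl fun i _ => by ring
  have hx0 : 0 ≤ x n ⬝ᵥ x n := (sq_nonneg _).trans hb
  obtain ⟨m, rfl⟩ := Nat.exists_eq_add_of_le' hn
  rw [Nat.add_sub_cancel] at hmin hmax
  have hN : ((m + 1 : ℕ) : ℝ) = (m : ℝ) + 1 := by push_cast; ring
  have hN0 : (0 : ℝ) ≤ (m : ℝ) + 1 := by positivity
  rw [hN] at h1 h2 ⊢
  have hDlow : b q₀ ^ 2 * c₂ * ((m : ℝ) + 1) - γ ^ 2 ≤ D := by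
    have e1 := (mul_le_mul_of_nonneg_right hmin hx0).trans (lambdaMin_mul_le s u ps q₀ m _)
    have e2 := mul_le_mul_of_nonneg_left hb (mul_nonneg hc₂.le hN0)
    linarith
  have hDup : D ≤ c₄ * ((m : ℝ) + 1) * γ ^ 2 := by
    have e1 := (le_lambdaMax_mul s u ps q₀ m (x (m + 1))).trans
      (mul_le_mul_of_nonneg_right hmax hx0)
    have e2 := mul_le_mul_of_nonneg_left hxn (mul_nonneg hc₄.le hN0)
    linarith
  have hCS : |E| ≤ γ * Real.sqrt (c₄ * K) * ((m : ℝ) + 1) := by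
    refine abs_le_of_sq_le_sq ?_ (by positivity)
    refine (Finset.sum_mul_sq_le_sq_mul_sq _ _ _).trans ?_
    rw [mul_pow, mul_pow, Real.sq_sqrt (mul_nonneg hc₄.le hK)]
    refine (mul_le_mul hDup h1 (Finset.sum_nonneg fun i _ => sq_nonneg _)
      (by positivity)).trans (le_of_eq ?_)
    ring
  have h5 := neg_abs_le (∑ i ∈ Finset.range (m + 1), (x (m + 1) ⬝ᵥ regressor s u ps q₀ i) * w (i + 1))
  have h6 := neg_abs_le E
  rw [h4]
  linarith

/-- Pathwise consistency of the order estimate. -/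
theorem tendsto_orderEstimate (hp₀ : p₀ ≤ ps) (hc₂ : 0 < c₂) (hq₀ : 1 ≤ q₀) (hq₀s : q₀ ≤ qs)
    {c₄ γ β₁ β₂ : ℝ} {v : ℕ → ℝ} {qhat : ℕ → ℕ} (hc₄ : 0 < c₄) (hK : 0 < K)
    (hη : ∀ᶠ n : ℕ in atTop,
      ∑ i ∈ Finset.range n, (modelError p₀ q₀ a b s u ps i - w (i + 1)) ^ 2 ≤ K * n)
    (hnoise : ∀ q ≤ qs, ∀ k, Tendsto
      (fun n : ℕ => (∑ i ∈ Finset.range n, regressor s u ps q i k * w (i + 1)) / n) atTop (𝓝 0))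
    (hs : ∀ᶠ n : ℕ in atTop, ∑ i ∈ Finset.range n, s (i + 1) ^ 2 ≤ C * n)
    (hPE : ∀ q ≤ qs, ∀ᶠ n : ℕ in atTop, c₂ * ((n : ℝ) + 1) ≤ lambdaMin s u ps q n)
    (hmax : ∀ᶠ n : ℕ in atTop, lambdaMax s u ps q₀ n ≤ c₄ * ((n : ℝ) + 1))
    (hγ : ∀ q ≤ q₀, ∀ᶠ n : ℕ in atTop, errorNorm p₀ q₀ a b s u ps q n ≤ γ)
    (hβ₁ : 0 < β₁) (hβ₂ : 0 < β₂) (hβ₂' : β₂ < 1)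
    (hv : ∀ n : ℕ, 1 ≤ n → (5 * K + β₁) * n ≤ v n)
    (hv' : ∀ n : ℕ, 1 ≤ n → v n ≤ β₂ / qs *
      (b q₀ ^ 2 * c₂ - 2 * γ * Real.sqrt (c₄ * K) - 3 * K) * n)
    (hqhat : ∀ n, IsOrderEstimate v s u ps qs n (qhat n)) :
    Tendsto qhat atTop (𝓝 q₀) := by
  set B := thetaBar p₀ q₀ a b ps q₀ ⬝ᵥ thetaBar p₀ q₀ a b ps q₀ with hB
  have hqs : (0 : ℝ) < qs := by exact_mod_cast hq₀.trans hq₀s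
  have hlin : ∀ {A : ℝ}, 0 < A → ∀ R : ℝ, ∀ᶠ n : ℕ in atTop, R < A * n := fun hA R =>
    (tendsto_natCast_atTop_atTop.const_mul_atTop hA).eventually_gt_atTop R
  have hσ₀ : ∀ n, sigma s u ps q₀ n
      ≤ ∑ i ∈ Finset.range n, modelError p₀ q₀ a b s u ps i ^ 2 + B := fun n =>
    sigma_le s u ps q₀ n _
  have hlt : ∀ q ≤ qs, q ≠ q₀ → ∀ᶠ n in atTop,
      criterion v s u ps q₀ n < criterion v s u ps q n := by
    intro q hq hne
    rcases lt_or_gt_of_ne hne with hlt | hgt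
    -- Order too small: with slack `e = K`, and another `K n` for the constants `B + γ²`, the gain
    -- in `σ` from passing to `q₀` exceeds `(D - 2K) n`, while the penalty costs at most `v n * qs`.
    · filter_upwards [eventually_le_sigma_of_lt hc₂ hlt hc₄ hK.le hη (hnoise q₀ hq₀s)
        (hPE q₀ hq₀s) hmax (hγ q hlt.le) hK, hlin hK (B + γ ^ 2), eventually_ge_atTop 1]
        with n h1 h2 hn
      have hn0 : (0 : ℝ) < n := by exact_mod_cast hn
      set D := b q₀ ^ 2 * c₂ - 2 * γ * Real.sqrt (c₄ * K) with hD
      have hvpos : 0 < v n := lt_of_lt_of_le (by positivity) (hv n hn)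
      have h3 : v n * qs ≤ β₂ * ((D - 3 * K) * n) := by
        refine (mul_le_mul_of_nonneg_right (hv' n hn) hqs.le).trans (le_of_eq ?_)
        field_simp
      -- Positivity of the bracket is not assumed; it is forced by `0 < v n` and the upper bound on
      -- `v n`.
      have h4 : 0 < (D - 3 * K) * n :=
        pos_of_mul_pos_right ((mul_pos hvpos hqs).trans_le h3) hβ₂.le
      have h5 : v n * ((q₀ : ℝ) - q) ≤ v n * qs := by
        refine mul_le_mul_of_nonneg_left ?_ hvpos.le
        have : (q₀ : ℝ) ≤ qs := by exact_mod_cast hq₀s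
        linarith [q.cast_nonneg (α := ℝ)]
      have h6 : β₂ * ((D - 3 * K) * n) < (D - 3 * K) * n := mul_lt_of_lt_one_left h4 hβ₂'
      have h7 := hσ₀ n
      have h8 : 0 < K * n := by positivity
      simp only [criterion]
      linarith
    -- Order too large: `σ` drops by less than `(K + β₁) n`, with one half of `β₁` for the noise and
    -- one half for `B`, while the penalty rises by at least `v n`.
    · filter_upwards [eventually_sum_sq_le_sigma hp₀ hc₂ hgt.le hη (hnoise q hq) hs (hPE q hq)
        (half_pos hβ₁), hlin (half_pos hβ₁) B, eventually_ge_atTop 1] with n h1 h2 hn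
      have hn0 : (0 : ℝ) < n := by exact_mod_cast hn
      have hvn := hv n hn
      have hvpos : 0 < v n := lt_of_lt_of_le (by positivity) hvn
      have h5 : v n * 1 ≤ v n * ((q : ℝ) - q₀) := by
        refine mul_le_mul_of_nonneg_left ?_ hvpos.le
        have : (q₀ : ℝ) + 1 ≤ q := by exact_mod_cast hgt
        linarith
      have h7 := hσ₀ n
      have h8 : 0 < K * n := by positivity
      simp only [criterion]
      linarith
  have hall : ∀ᶠ n in atTop, ∀ q ∈ Finset.range (qs + 1), q ≠ q₀ →
      criterion v s u ps q₀ n < criterion v s u ps q n := by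
    rw [Filter.eventually_all_finset]
    intro q hq
    by_cases h : q = q₀
    · exact Eventually.of_forall fun n hne => absurd h hne
    · filter_upwards [hlt q (by have := Finset.mem_range.1 hq; omega) h] with n hn _
      exact hn
  refine tendsto_const_nhds.congr' ?_
  filter_upwards [hall] with n hn
  by_contra hne
  have h1 := hn (qhat n) (Finset.mem_range.2 (Nat.lt_succ_of_le (hqhat n).1)) (Ne.symm hne)
  exact absurd ((hqhat n).2 q₀ hq₀s) (not_le.2 h1)

end Consistency

end QuantARX

/-! ### Mean-square bounds for the data and the constants they produce -/

namespace QuantARX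

section Growth

theorem LinearGrowth.mono_const {K L : ℝ} {f : ℕ → ℝ} (hf : LinearGrowth K f) (h : K ≤ L) :
    LinearGrowth L f := by
  obtain ⟨R, hR⟩ := hf
  exact ⟨R, fun n => (hR n).trans (by gcongr)⟩

theorem exists_linearGrowth_output {p₀ q₀ : ℕ} {a b : ℕ → ℝ} {c δ : ℝ} (hstable : IsStable p₀ a)
    (hbc : ∀ j, 1 ≤ j → j ≤ q₀ → |b j| ≤ c) (K : ℝ) :
    ∃ C : ℝ, 0 ≤ C ∧ ∀ y u w : ℕ → ℝ, IsARXPath p₀ q₀ a b y u w → (∀ n, |u (n + 1)| ≤ δ) →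
      LinearGrowth K (fun i => w (i + 1) ^ 2) → LinearGrowth C fun i => y i ^ 2 := by
  obtain ⟨C, hC⟩ := exists_linearGrowth_of_isStable hstable (2 * (q₀ * (c * δ)) ^ 2 + 2 * |K|)
  refine ⟨|C|, abs_nonneg C, fun y u w hARX hu hw => ?_⟩
  refine (hC y ?_).mono_const (le_abs_self C)
  -- A delay by 0 passes from bounds on `w (i + 1)` to bounds on `w i`; the uncontrolled value `w 0`
  -- goes into the additive constant.
  have hw1 : LinearGrowth |K| fun i => w (i - 0) ^ 2 :=
    (hw.mono_const (le_abs_self K)).delay (f := fun i => w i ^ 2) (fun i => sq_nonneg _)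
      (abs_nonneg K) 0
  have hw2 : LinearGrowth |K| fun i => w (i + p₀) ^ 2 :=
    LinearGrowth.shift (f := fun i => w i ^ 2) hw1 (fun i => sq_nonneg _) p₀
  refine ((LinearGrowth.const _).add (hw2.const_mul zero_le_two)).of_eventually_le ?_
  -- Beyond `q₀` only inputs at times at least 1 occur, where `|u| ≤ δ`; nothing is known about the
  -- size of `u 0`.
  filter_upwards [eventually_gt_atTop q₀] with n hn
  obtain ⟨m, hm⟩ : ∃ m, n + p₀ = m + 1 := ⟨n + p₀ - 1, by omega⟩
  have hrec := hARX m
  rw [← hm] at hrec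
  have h1 : ∑ i ∈ Finset.Icc 1 p₀, a i * fromZero y ((m : ℤ) + 1 - i)
      = ∑ i ∈ Finset.Icc 1 p₀, a i * y (n + p₀ - i) := by
    refine Finset.sum_congr rfl fun i hi => ?_
    have hi := Finset.mem_Icc.1 hi
    rw [fromZero, if_pos (by omega), show ((m : ℤ) + 1 - i).toNat = n + p₀ - i by omega]
  rw [h1] at hrec
  rw [hrec]
  have h2 : |∑ j ∈ Finset.Icc 1 q₀, b j * fromZero u ((m : ℤ) + 1 - j)| ≤ q₀ * (c * δ) := by
    refine (Finset.abs_sum_le_sum_abs _ _).trans ?_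
    refine (Finset.sum_le_card_nsmul _ _ (c * δ) fun j hj => ?_).trans ?_
    · have hj := Finset.mem_Icc.1 hj
      rw [abs_mul]
      have hb := hbc j hj.1 hj.2
      obtain ⟨l, hl⟩ : ∃ l : ℕ, ((m : ℤ) + 1 - j).toNat = l + 1 :=
        ⟨m - j, by omega⟩
      rw [fromZero, if_pos (by omega), hl]
      exact mul_le_mul hb (hu l) (abs_nonneg _) ((abs_nonneg _).trans hb)
    · simp
  have h3 := sq_le_sq' (abs_le.1 h2).1 (abs_le.1 h2).2
  set S := ∑ j ∈ Finset.Icc 1 q₀, b j * fromZero u ((m : ℤ) + 1 - j)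
  nlinarith [sq_nonneg (S - w (n + p₀))]

theorem linearGrowth_quantized {C ε : ℝ} (hε : 0 < ε) {y s : ℕ → ℝ}
    (hs : ∀ n, s n = quantize ε (y n)) (hy : LinearGrowth C fun i => y i ^ 2) :
    LinearGrowth (2 * C + 2 * (ε / 2) ^ 2) fun i => s i ^ 2 := by
  refine ((hy.const_mul zero_le_two).add (LinearGrowth.const _)).mono fun i => ?_
  have h := abs_quantize_sub_le hε (y i)
  rw [← hs] at h
  have h3 := sq_le_sq' (abs_le.1 h).1 (abs_le.1 h).2
  nlinarith [sq_nonneg (s i - 2 * y i)]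

theorem linearGrowth_regressor {L : ℝ} {s u : ℕ → ℝ} (hL : 0 ≤ L)
    (hs : LinearGrowth L fun i => s (i + 1) ^ 2) (hu : LinearGrowth L fun i => u (i + 1) ^ 2)
    (p q : ℕ) (k : Fin p ⊕ Fin q) : LinearGrowth L fun i => regressor s u p q i k ^ 2 := by
  have key : ∀ x : ℕ → ℝ, LinearGrowth L (fun i => x (i + 1) ^ 2) → ∀ m : ℕ,
      LinearGrowth L fun i => fromOne x ((i : ℤ) - m) ^ 2 := by
    intro x hx m
    refine (hx.delay (f := fun i => x i ^ 2) (fun i => sq_nonneg _) hL m).mono fun i => ?_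
    by_cases h : (0 : ℤ) < (i : ℤ) - m
    · rw [fromOne, if_pos h, show ((i : ℤ) - m).toNat = i - m by omega]
    · rw [fromOne, if_neg h]
      simpa using sq_nonneg (x (i - m))
  rcases k with k | k
  · exact key s hs k
  · exact key u hu k

theorem eventually_lambdaMax_le {L : ℝ} {s u : ℕ → ℝ} (hL : 0 ≤ L)
    (hs : LinearGrowth L fun i => s (i + 1) ^ 2) (hu : LinearGrowth L fun i => u (i + 1) ^ 2)
    (p q : ℕ) : ∀ᶠ n : ℕ in atTop,
      lambdaMax s u p q n ≤ (p + q) * (L + 2) * ((n : ℝ) + 1) := by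
  have h : ∀ᶠ n : ℕ in atTop, ∀ k, ∑ i ∈ Finset.range (n + 1), regressor s u p q i k ^ 2
      ≤ (L + 1) * ((n + 1 : ℕ) : ℝ) :=
    eventually_all.2 fun k => (tendsto_add_atTop_nat 1).eventually
      ((linearGrowth_regressor hL hs hu p q k).eventually_le (lt_add_one L))
  filter_upwards [h] with n hn
  refine (lambdaMax_le s u p q n).trans ?_
  have h1 := Finset.sum_le_card_nsmul Finset.univ _ _ fun k _ => hn k
  simp only [Finset.card_univ, Fintype.card_sum, Fintype.card_fin, nsmul_eq_mul] at h1
  push_cast at h1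
  have h2 : (0 : ℝ) ≤ (p + q) * n := by positivity
  linarith

theorem eventually_errorNorm_le {p₀ q₀ p q : ℕ} {a b s u : ℕ → ℝ} {c₂ C : ℝ} (hc₂ : 0 < c₂)
    (hq : q ≤ q₀)
    (hPE : ∀ᶠ n : ℕ in atTop, c₂ * ((n : ℝ) + 1) ≤ lambdaMin s u p q n)
    (hs : ∀ᶠ n : ℕ in atTop, ∑ i ∈ Finset.range n, s (i + 1) ^ 2 ≤ C * n) :
    ∀ᶠ n in atTop, errorNorm p₀ q₀ a b s u p q n ≤
      Real.sqrt (2 * (thetaBar p₀ q₀ a b p q₀ ⬝ᵥ thetaBar p₀ q₀ a b p q₀) + 2 * (C / c₂)) := by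
  filter_upwards [eventually_thetaHat_le hc₂ hPE hs] with n hn
  refine Real.le_sqrt_of_sq_le ?_
  rw [sq_errorNorm]
  refine (sub_dotProduct_self_le _ _).trans ?_
  rw [paddedEstimate_dotProduct_self _ _ _ _ hq]
  linarith

/-- The error is bounded pointwise only from time `max p₀ q₀` on; the strict inequality for `K`
absorbs the earlier terms. -/
theorem eventually_sum_sq_modelError_sub_le {p₀ q₀ p : ℕ} {a b y u w s : ℕ → ℝ} {ε c K : ℝ}
    (hε : 0 < ε) (hARX : IsARXPath p₀ q₀ a b y u w) (hs : ∀ n, s n = quantize ε (y n))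
    (hac : ∀ i, 1 ≤ i → i ≤ p₀ → |a i| ≤ c) (hp : p₀ ≤ p)
    (hK : ((1 + p₀ * c) * ε / 2) ^ 2 < K) :
    ∀ᶠ n : ℕ in atTop,
      ∑ i ∈ Finset.range n, (modelError p₀ q₀ a b s u p i - w (i + 1)) ^ 2 ≤ K * n := by
  refine LinearGrowth.eventually_le ((LinearGrowth.const _).of_eventually_le ?_) hK
  filter_upwards [eventually_ge_atTop p₀, eventually_ge_atTop q₀] with i h1 h2
  have h := abs_regression_error_le hε hARX hs hac hp h1 h2
  exact sq_le_sq' (abs_le.1 h).1 (abs_le.1 h).2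

end Growth

/-! ### Adaptedness to the past of the system -/

section History

variable {Ω : Type*} {y u w s : ℕ → Ω → ℝ}

/-- The past `(y₀, u₀, …, u_n, w₁, …, w_n)`. -/
def history (y u w : ℕ → Ω → ℝ) (n : ℕ) (ω : Ω) : ℝ × (Fin (n + 1) → ℝ) × (Fin n → ℝ) :=
  (y 0 ω, (fun i : Fin (n + 1) => u i ω), (fun i : Fin n => w (i + 1) ω))

theorem measurable_history {m : MeasurableSpace Ω} {n : ℕ} (hy : Measurable[m] (y 0))
    (hu : ∀ i ≤ n, Measurable[m] (u i)) (hw : ∀ i < n, Measurable[m] (w (i + 1))) :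
    Measurable[m] (history y u w n) :=
  hy.prodMk ((measurable_pi_lambda _ fun _ => hu _ (Nat.le_of_lt_succ (Fin.is_lt _))).prodMk
    (measurable_pi_lambda _ fun i => hw _ (Fin.is_lt i)))

theorem measurable_output_zero_history (n : ℕ) :
    Measurable[MeasurableSpace.comap (history y u w n) inferInstance] (y 0) :=
  measurable_fst.comp (comap_measurable (history y u w n))

theorem measurable_input_history {n i : ℕ} (hi : i ≤ n) :
    Measurable[MeasurableSpace.comap (history y u w n) inferInstance] (u i) :=
  ((measurable_pi_apply (⟨i, Nat.lt_succ_of_le hi⟩ : Fin (n + 1))).comp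
    (measurable_fst.comp measurable_snd)).comp (comap_measurable (history y u w n))

theorem measurable_noise_history {n i : ℕ} (hi : i < n) :
    Measurable[MeasurableSpace.comap (history y u w n) inferInstance] (w (i + 1)) :=
  ((measurable_pi_apply (⟨i, hi⟩ : Fin n)).comp
    (measurable_snd.comp measurable_snd)).comp (comap_measurable (history y u w n))

/-- The filtration generated by the past of the system. -/
def pastFiltration [mΩ : MeasurableSpace Ω] (hy : Measurable (y 0))
    (hu : ∀ n, Measurable (u n)) (hw : ∀ n, Measurable (w (n + 1))) : Filtration ℕ mΩ where
  seq n := MeasurableSpace.comap (history y u w n) inferInstance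
  mono' := monotone_nat_of_le_succ fun n =>
    (measurable_history (measurable_output_zero_history (n + 1))
      (fun _ hi => measurable_input_history (hi.trans n.le_succ))
      (fun _ hi => measurable_noise_history (hi.trans n.lt_succ_self))).comap_le
  le' _ := (measurable_history hy (fun i _ => hu i) fun i _ => hw i).comap_le

theorem measurable_fromZero {m : MeasurableSpace Ω} {x : ℕ → Ω → ℝ} {n : ℕ}
    (hx : ∀ i ≤ n, Measurable[m] (x i)) {j : ℤ} (hj : j ≤ n) :
    Measurable[m] fun ω => fromZero (fun i => x i ω) j := by
  unfold fromZero
  split_ifs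
  · exact hx _ (by omega)
  · exact measurable_const

theorem measurable_fromOne {m : MeasurableSpace Ω} {x : ℕ → Ω → ℝ} {n : ℕ}
    (hx : ∀ i ≤ n, Measurable[m] (x i)) {j : ℤ} (hj : j ≤ n) :
    Measurable[m] fun ω => fromOne (fun i => x i ω) j := by
  unfold fromOne
  split_ifs
  · exact hx _ (by omega)
  · exact measurable_const

theorem measurable_quantize (ε : ℝ) : Measurable (quantize ε) :=
  (measurable_from_top.comp
    (Int.measurable_floor.comp ((measurable_id.div_const ε).add_const _))).const_mul ε

/-- Outputs after time 0 are not part of the history; the recursion reconstructs them from `y 0`,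
the inputs and the noise. -/
theorem measurable_output_history {p₀ q₀ : ℕ} {a b : ℕ → ℝ}
    (hARX : ∀ ω, IsARXPath p₀ q₀ a b (fun n => y n ω) (fun n => u n ω) (fun n => w n ω)) (n : ℕ) :
    ∀ i ≤ n, Measurable[MeasurableSpace.comap (history y u w n) inferInstance] (y i) := by
  intro i
  induction i using Nat.strong_induction_on with
  | _ i ih =>
    intro hi
    cases i with
    | zero => exact measurable_output_zero_history n
    | succ i =>
      have hrec : y (i + 1) = fun ω =>
          ∑ j ∈ Finset.Icc 1 q₀, b j * fromZero (fun n => u n ω) ((i : ℤ) + 1 - j) + w (i + 1) ω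
            - ∑ j ∈ Finset.Icc 1 p₀, a j * fromZero (fun n => y n ω) ((i : ℤ) + 1 - j) := by
        ext ω
        rw [← hARX ω i]
        ring
      rw [hrec]
      refine Measurable.sub (Measurable.add ?_ (measurable_noise_history hi)) ?_
      · refine Finset.measurable_sum _ fun j hj => Measurable.const_mul ?_ _
        have := Finset.mem_Icc.1 hj
        exact measurable_fromZero (n := n) (fun l hl => measurable_input_history hl) (by omega)
      · refine Finset.measurable_sum _ fun j hj => Measurable.const_mul ?_ _
        have := Finset.mem_Icc.1 hj
        exact measurable_fromZero (n := i) (fun l hl => ih l (by omega) (by omega)) (by omega)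

theorem measurable_regressor_history {p₀ q₀ : ℕ} {a b : ℕ → ℝ} {ε : ℝ}
    (hARX : ∀ ω, IsARXPath p₀ q₀ a b (fun n => y n ω) (fun n => u n ω) (fun n => w n ω))
    (hs : ∀ n ω, s n ω = quantize ε (y n ω)) (p q n : ℕ) (k : Fin p ⊕ Fin q) :
    Measurable[MeasurableSpace.comap (history y u w n) inferInstance]
      fun ω => regressor (fun n => s n ω) (fun n => u n ω) p q n k := by
  rcases k with k | k
  · refine measurable_fromOne (n := n) (x := s) (fun i hi => ?_) (by omega)
    have : s i = fun ω => quantize ε (y i ω) := funext (hs i)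
    rw [this]
    exact (measurable_quantize ε).comp (measurable_output_history hARX n i hi)
  · exact measurable_fromOne (n := n) (x := u) (fun i hi => measurable_input_history hi) (by omega)

end History

/-! ### Almost sure properties of the input and the noise -/

section Probability

variable {Ω : Type*} [MeasurableSpace Ω] {P : Measure Ω}

theorem ae_abs_le_of_isUniform {X : Ω → ℝ} {δ : ℝ} (hX : Measurable X)
    (h : pdf.IsUniform X (Set.Icc (-δ) δ) P volume) : ∀ᵐ ω ∂P, |X ω| ≤ δ := by
  have h1 : ∀ᵐ x ∂(P.map X), x ∈ Set.Icc (-δ) δ := by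
    rw [show P.map X = _ from h]
    exact ae_cond_mem measurableSet_Icc
  filter_upwards [ae_of_ae_map hX.aemeasurable h1] with ω hω
  exact abs_le.2 hω

theorem memLp_two_of_gaussian {X : Ω → ℝ} (hX : Measurable X)
    (h : P.map X = gaussianReal 0 1) : MemLp X 2 P := by
  have := memLp_id_gaussianReal (μ := 0) (v := 1) 2
  rw [← h, memLp_map_measure_iff aestronglyMeasurable_id hX.aemeasurable] at this
  exact this

theorem integral_of_gaussian {X : Ω → ℝ} (hX : Measurable X)
    (h : P.map X = gaussianReal 0 1) : ∫ ω, X ω ∂P = 0 := by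
  have := integral_id_gaussianReal (μ := 0) (v := 1)
  rw [← h, integral_map (f := fun x : ℝ => x) hX.aemeasurable aestronglyMeasurable_id] at this
  exact this

theorem integral_sq_of_gaussian {X : Ω → ℝ} (hX : Measurable X)
    (h : P.map X = gaussianReal 0 1) : ∫ ω, X ω ^ 2 ∂P = 1 := by
  have h1 := variance_id_gaussianReal (μ := 0) (v := 1)
  rw [← h, variance_map aemeasurable_id hX.aemeasurable, Function.id_comp,
    variance_of_integral_eq_zero hX.aemeasurable (integral_of_gaussian hX h)] at h1
  simpa using h1

/-- Strong law of large numbers for the squares, whose mean is 1; any slope above 1 would do. -/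
theorem ae_linearGrowth_sq_of_gaussian {X : ℕ → Ω → ℝ} (hX : ∀ n, Measurable (X n))
    (hind : iIndepFun X P) (h : ∀ n, P.map (X n) = gaussianReal 0 1) :
    ∀ᵐ ω ∂P, LinearGrowth 2 fun i => X i ω ^ 2 := by
  have hlaw := strong_law_ae_real (μ := P) (fun n ω => X n ω ^ 2)
    (memLp_two_of_gaussian (hX 0) (h 0)).integrable_sq
    (fun i j hij => (hind.indepFun hij).comp (measurable_id.pow_const 2) (measurable_id.pow_const 2))
    (fun i => IdentDistrib.comp (u := fun x : ℝ => x ^ 2)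
      ⟨(hX i).aemeasurable, (hX 0).aemeasurable, by rw [h, h]⟩ (measurable_id.pow_const 2))
  filter_upwards [hlaw] with ω hω
  rw [integral_sq_of_gaussian (hX 0) (h 0)] at hω
  refine LinearGrowth.of_eventually_sum_le ?_
  filter_upwards [hω.eventually_lt_const one_lt_two, eventually_gt_atTop 0] with n hn hn0
  have hpos : (0 : ℝ) < n := by exact_mod_cast hn0
  exact ((div_lt_iff₀ hpos).1 hn).le

variable [IsProbabilityMeasure P]

/-- The correlation between the regressors and the noise is `o(n)` when the regressors are
mean-square bounded. -/
theorem ae_tendsto_regressor_noise_div {p₀ q₀ : ℕ} {a b : ℕ → ℝ} {ε : ℝ}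
    {y u w s : ℕ → Ω → ℝ} (hy : Measurable (y 0)) (hu : ∀ n, Measurable (u n))
    (hw : ∀ n, Measurable (w (n + 1)))
    (hARX : ∀ ω, IsARXPath p₀ q₀ a b (fun n => y n ω) (fun n => u n ω) (fun n => w n ω))
    (hs : ∀ n ω, s n ω = quantize ε (y n ω))
    (hlaw : ∀ n, P.map (w (n + 1)) = gaussianReal 0 1)
    (hpast : ∀ n, IndepFun (w (n + 1)) (history y u w n) P) (p : ℕ) :
    ∀ᵐ ω ∂P, ∀ (q : ℕ) (k : Fin p ⊕ Fin q) (K : ℝ),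
      LinearGrowth K (fun i => regressor (fun n => s n ω) (fun n => u n ω) p q i k ^ 2) →
      Tendsto (fun n : ℕ => (∑ i ∈ Finset.range n,
        regressor (fun n => s n ω) (fun n => u n ω) p q i k * w (i + 1) ω) / n) atTop (𝓝 0) := by
  refine ae_all_iff.2 fun q => ae_all_iff.2 fun k => ?_
  exact ae_tendsto_sum_mul_noise_div (ℱ := pastFiltration hy hu hw)
    (ξ := fun n => w (n + 1))
    (φ := fun i ω => regressor (fun n => s n ω) (fun n => u n ω) p q i k)
    (fun n => measurable_noise_history n.lt_succ_self)
    (fun n => (IndepFun_iff_Indep _ _ P).1 (hpast n))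
    (fun n => memLp_two_of_gaussian (hw n) (hlaw n))
    (fun n => integral_of_gaussian (hw n) (hlaw n))
    (fun n => integral_sq_of_gaussian (hw n) (hlaw n))
    (fun n => measurable_regressor_history hARX hs p q n k)

end Probability

end QuantARX

/-! ### Assembly of the pathwise and almost sure statements -/

theorem theorem2
    {Ω : Type*} [MeasurableSpace Ω] (P : Measure Ω) [IsProbabilityMeasure P]
    -- orders, their known bounds, coefficients, quantization step, constants
    (p₀ q₀ ps qs : ℕ) (a b : ℕ → ℝ) (ε c δ c₂ : ℝ)
    -- output, input, noise, quantized output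
    (y u w s : ℕ → Ω → ℝ)
    (ha : p₀ ≠ 0 → a p₀ ≠ 0) (hb : b q₀ ≠ 0)
    (hy0 : Measurable (y 0)) (hu0 : Measurable (u 0))
    (hu : ∀ n, Measurable (u (n + 1))) (hw : ∀ n, Measurable (w (n + 1)))
    (hARX : ∀ ω, QuantARX.IsARXPath p₀ q₀ a b
      (fun n => y n ω) (fun n => u n ω) (fun n => w n ω))
    (hε : 0 < ε)
    (hs : ∀ n ω, s n ω = QuantARX.quantize ε (y n ω))
    -- the noise is i.i.d. standard Gaussian and independent of the past
    (hw_indep : iIndepFun (fun n => w (n + 1)) P)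
    (hw_law : ∀ n, P.map (w (n + 1)) = gaussianReal 0 1)
    (hw_past : ∀ n : ℕ, IndepFun (w (n + 1))
      (fun ω => (y 0 ω, (fun i : Fin (n + 1) => u i ω), (fun i : Fin n => w (i + 1) ω))) P)
    -- the input is i.i.d. uniform on `[-δ, δ]`
    (hδ : 0 < δ)
    (hu_indep : iIndepFun (fun n => u (n + 1)) P)
    (hu_law : ∀ n, pdf.IsUniform (u (n + 1)) (Set.Icc (-δ) δ) P volume)
    -- stability
    (hstable : QuantARX.IsStable p₀ a)
    -- bounded coefficients and small quantization step
    (hc : 0 < c)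
    (hac : ∀ i, 1 ≤ i → i ≤ p₀ → |a i| ≤ c)
    (hbc : ∀ j, 1 ≤ j → j ≤ q₀ → |b j| ≤ c)
    (hεc : ε < 1 / (2 * (1 + p₀ * c)))
    -- known bounds on the orders
    (hps : 0 < ps) (hp₀ : p₀ ≤ ps) (hq₀ : 1 ≤ q₀) (hq₀s : q₀ ≤ qs)
    -- persistent excitation
    (hc₂ : 0 < c₂)
    (hPE : ∀ q ≤ qs, ∀ᵐ ω ∂P, ∀ᶠ n : ℕ in atTop,
      c₂ * ((n : ℝ) + 1) ≤ QuantARX.lambdaMin (fun n => s n ω) (fun n => u n ω) ps q n) :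
    -- constants `c₄` and `γ'` with the required properties exist
    (∃ c₄ : ℝ, 0 < c₄ ∧ ∀ᵐ ω ∂P, ∀ᶠ n : ℕ in atTop,
      QuantARX.lambdaMax (fun n => s n ω) (fun n => u n ω) ps q₀ n ≤ c₄ * ((n : ℝ) + 1)) ∧
    (∃ γ' : ℝ, ∀ q ≤ q₀, ∀ᵐ ω ∂P, ∀ᶠ n : ℕ in atTop,
      QuantARX.errorNorm p₀ q₀ a b (fun n => s n ω) (fun n => u n ω) ps q n ≤ γ') ∧
    -- and for all such constants the order estimate is strongly consistent
    (∀ (c₄ γ' β₁ β₂ : ℝ) (v : ℕ → ℝ) (qhat : ℕ → Ω → ℕ),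
      0 < c₄ →
      (∀ᵐ ω ∂P, ∀ᶠ n : ℕ in atTop,
        QuantARX.lambdaMax (fun n => s n ω) (fun n => u n ω) ps q₀ n ≤ c₄ * ((n : ℝ) + 1)) →
      (∀ q ≤ q₀, ∀ᵐ ω ∂P, ∀ᶠ n : ℕ in atTop,
        QuantARX.errorNorm p₀ q₀ a b (fun n => s n ω) (fun n => u n ω) ps q n ≤ γ') →
      0 < β₁ → 0 < β₂ → β₂ < 1 →
      (∀ n : ℕ, 1 ≤ n → (5 * (1 + ps * c) * ε + β₁) * n ≤ v n) →
      (∀ n : ℕ, 1 ≤ n → v n ≤ β₂ / qs *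
        ((b q₀) ^ 2 * c₂ - 2 * γ' * Real.sqrt (c₄ * (1 + ps * c) * ε)
          - 3 * (1 + ps * c) * ε) * n) →
      (∀ n ω, QuantARX.IsOrderEstimate v (fun n => s n ω) (fun n => u n ω) ps qs n (qhat n ω)) →
      ∀ᵐ ω ∂P, Tendsto (fun n => qhat n ω) atTop (𝓝 q₀)) := by
  have hu' : ∀ n, Measurable (u n) := fun n => by
    cases n with
    | zero => exact hu0
    | succ n => exact hu n
  -- `Cy` is fixed before any sample path, which makes `c₄` and `γ'` deterministic; 2 is the slope
  -- available for the squared noise.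
  obtain ⟨Cy, hCy, hgrowth⟩ := QuantARX.exists_linearGrowth_output (δ := δ) hstable hbc 2
  set Cs := 2 * Cy + 2 * (ε / 2) ^ 2 with hCs
  set L := max Cs (δ ^ 2) with hL
  have hL0 : 0 ≤ L := (sq_nonneg δ).trans (le_max_right _ _)
  have hsu : ∀ᵐ ω ∂P, QuantARX.LinearGrowth L (fun i => s (i + 1) ω ^ 2) ∧
      QuantARX.LinearGrowth L (fun i => u (i + 1) ω ^ 2) := by
    filter_upwards [ae_all_iff.2 fun n => QuantARX.ae_abs_le_of_isUniform (hu n) (hu_law n),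
      QuantARX.ae_linearGrowth_sq_of_gaussian hw hw_indep hw_law] with ω hU hW
    have hY := hgrowth _ _ _ (hARX ω) hU hW
    have hS := QuantARX.linearGrowth_quantized hε (fun n => hs n ω) hY
    refine ⟨(QuantARX.LinearGrowth.shift (f := fun i => s i ω ^ 2) hS
      (fun i => sq_nonneg _) 1).mono_const (le_max_left _ _), ?_⟩
    refine ((QuantARX.LinearGrowth.const (δ ^ 2)).mono fun i => ?_).mono_const (le_max_right _ _)
    exact sq_le_sq' (abs_le.1 (hU i)).1 (abs_le.1 (hU i)).2
  have hssum : ∀ᵐ ω ∂P, ∀ᶠ n : ℕ in atTop,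
      ∑ i ∈ Finset.range n, s (i + 1) ω ^ 2 ≤ (L + 1) * n := by
    filter_upwards [hsu] with ω h
    exact h.1.eventually_le (lt_add_one L)
  refine ⟨⟨(ps + q₀) * (L + 2), ?_, ?_⟩, ⟨Real.sqrt (2 * (QuantARX.thetaBar p₀ q₀ a b ps q₀ ⬝ᵥ
    QuantARX.thetaBar p₀ q₀ a b ps q₀) + 2 * ((L + 1) / c₂)), fun q hq => ?_⟩, ?_⟩
  · have : (0 : ℝ) < ps := by exact_mod_cast hps
    positivity
  · filter_upwards [hsu] with ω h
    exact QuantARX.eventually_lambdaMax_le hL0 h.1 h.2 ps q₀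
  · filter_upwards [hPE q (hq.trans hq₀s), hssum] with ω h1 h2
    exact QuantARX.eventually_errorNorm_le hc₂ hq h1 h2
  · intro c₄ γ' β₁ β₂ v qhat hc₄ hmax hγ hβ₁ hβ₂ hβ₂' hv hv' hqhat
    have hnoise := QuantARX.ae_tendsto_regressor_noise_div hy0 hu' hw hARX hs hw_law hw_past ps
    have hps' : (p₀ : ℝ) ≤ ps := by exact_mod_cast hp₀
    have hκ0 : 0 < (1 + p₀ * c) * ε := by positivity
    have hκ : (1 + p₀ * c) * ε < 1 / 2 := by
      rw [lt_div_iff₀ (by positivity)] at hεc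
      linarith
    have hκK : (1 + p₀ * c) * ε ≤ (1 + ps * c) * ε := by gcongr
    -- Here the smallness of `ε` enters: `κ = (1 + p₀c)ε < 1/2` gives `(κ/2)² < κ`, so `K = (1 +
    -- p*c)ε`, the quantity in the bounds on `v`, dominates the squared equation error.
    have hsq : ((1 + p₀ * c) * ε / 2) ^ 2 < (1 + ps * c) * ε := by
      have aux : ∀ κ : ℝ, 0 < κ → κ < 1 / 2 → (κ / 2) ^ 2 < κ := fun κ h0 h1 => by nlinarith
      exact (aux _ hκ0 hκ).trans_le hκK
    have hvl : ∀ n : ℕ, 1 ≤ n → (5 * ((1 + ps * c) * ε) + β₁) * n ≤ v n := fun n hn => by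
      rw [← mul_assoc 5]
      exact hv n hn
    have hvu : ∀ n : ℕ, 1 ≤ n → v n ≤ β₂ / qs * (b q₀ ^ 2 * c₂
        - 2 * γ' * Real.sqrt (c₄ * ((1 + ps * c) * ε)) - 3 * ((1 + ps * c) * ε)) * n :=
      fun n hn => by
        rw [← mul_assoc 3, ← mul_assoc c₄]
        exact hv' n hn
    have hPE' : ∀ᵐ ω ∂P, ∀ q ≤ qs, ∀ᶠ n : ℕ in atTop, c₂ * ((n : ℝ) + 1) ≤
        QuantARX.lambdaMin (fun n => s n ω) (fun n => u n ω) ps q n :=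
      ae_all_iff.2 fun q => by
        by_cases hq : q ≤ qs
        · filter_upwards [hPE q hq] with ω h _ using h
        · exact ae_of_all _ fun ω h => absurd h hq
    have hγ' : ∀ᵐ ω ∂P, ∀ q ≤ q₀, ∀ᶠ n : ℕ in atTop,
        QuantARX.errorNorm p₀ q₀ a b (fun n => s n ω) (fun n => u n ω) ps q n ≤ γ' :=
      ae_all_iff.2 fun q => by
        by_cases hq : q ≤ q₀
        · filter_upwards [hγ q hq] with ω h _ using h
        · exact ae_of_all _ fun ω h => absurd h hq
    filter_upwards [hsu, hssum, hnoise, hPE', hγ', hmax] with ω h1 h2 h3 h4 h5 h6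
    have h7 := fun q (k : Fin ps ⊕ Fin q) =>
      h3 q k L (QuantARX.linearGrowth_regressor hL0 h1.1 h1.2 ps q k)
    have h8 := QuantARX.eventually_sum_sq_modelError_sub_le (q₀ := q₀) (u := fun n => u n ω)
      (w := fun n => w n ω) (s := fun n => s n ω) hε (hARX ω)
      (fun n => hs n ω) hac hp₀ hsq
    exact QuantARX.tendsto_orderEstimate (a := a) (b := b) (s := fun n => s n ω)
      (u := fun n => u n ω) (w := fun n => w n ω) (K := (1 + ps * c) * ε) (C := L + 1)
      (v := v) (γ := γ') (c₄ := c₄) hp₀ hc₂ hq₀ hq₀s hc₄ (hκ0.trans_le hκK) h8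
      (fun q _ => h7 q) h2 h4 h6 h5 hβ₁ hβ₂ hβ₂' hvl hvu (fun n => hqhat n ω)
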